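/- Let $0<\mu<\lambda$ and $0<\alpha<1$. A particle starts at the origin and moves on $[0,\infty)$ alternately upwards with velocity $1$ during times $U_1,U_2,\dots$ and downwards with velocity $-1$ during times $D_1,D_2,\dots$ (in the order $U_1,D_1,U_2,D_2,\dots$), where $(U_i)$ and $(D_i)$ are independent sequences of i.i.d. random variables, exponentially distributed with parameters $\lambda$ and $\mu$, respectively. Whenever the particle reaches the origin during a downward period $D_j$, it is absorbed there with probability $\alpha$; otherwise (with probability $1-\alpha$) it is reflected, i.e. the rest of $D_j$ is dropped and the motion restarts at once upwards, for the time $U_{j+1}$. The absorption trials are independent of each other and of the motion. Let $A_0$ be the time till absorption at the origin. Then $A_0<\infty$ almost surely and $\mathbb E(A_0^n)<\infty$ for every integer $n\ge 1$. If moreover $\mu+\lambda(\alpha-1)\neq 0$, then for every integer $n\ge 1$ $$ \mathbb E(A_0^n)=\frac{2\alpha\lambda\,n!}{[4\lambda\alpha(\mu+\lambda(\alpha-1))]^{n+1}}\Bigg\{[2\mu+2\lambda(\alpha-1)]\,[8\lambda(\alpha-1)]^n+\sum_{h=1}^n[4\lambda\alpha(\mu+\lambda(\alpha-1))]^h\,[8\lambda(\alpha-1)]^{n-h}\,\frac{\lambda\mu\,2^{h+1}}{(\lambda+\mu)^{h+1}}\;{}_2F_1\!\left(\frac{h+1}{2},\frac{h+2}{2};2;\frac{4\lambda\mu}{(\lambda+\mu)^2}\right)\Bigg\},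 $$ where ${}_2F_1(a,b;c;z)=\sum_{k=0}^{\infty}\frac{(a)_k(b)_k}{(c)_k}\frac{z^k}{k!}$ is the Gauss hypergeometric function and $(d)_0=1$, $(d)_k=d(d+1)\cdots(d+k-1)$. In all cases (also when $\mu+\lambda(\alpha-1)=0$), the mean and the variance of $A_0$ are $$ \mathbb E(A_0)=\frac{2}{\alpha(\lambda-\mu)},\qquad \operatorname{Var}(A_0)=\frac{4[\lambda+\mu(2\alpha-1)]}{\alpha^2(\lambda-\mu)^3}. $$ -/

import Mathlib

open MeasureTheory ProbabilityTheory
open scoped ENNReal Nat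

namespace ElasticTelegraph

/-- Height of the particle after `j` complete up-down rounds, when it starts at `x`. In round `j` it
moves up with velocity `1` for a time `u j` and then down with velocity `-1` for a time `d j`; the
downward motion is cut short as soon as the origin is reached, and the next round starts there. -/
noncomputable def height (x : ℝ) (u d : ℕ → ℝ) : ℕ → ℝ
  | 0 => x
  | j + 1 => max (height x u d j + u j - d j) 0

/-- In round `j` the particle reaches the origin during its downward period. -/
def ReachesOrigin (x : ℝ) (u d : ℕ → ℝ) (j : ℕ) : Prop :=
  height x u d j + u j ≤ d j

/-- Duration of round `j`: the upward period, then the downward period, truncated at the visit of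
the origin if there is one. -/
noncomputable def roundDuration (x : ℝ) (u d : ℕ → ℝ) (j : ℕ) : ℝ :=
  u j + min (d j) (height x u d j + u j)

/-- Time at which round `j` ends. -/
noncomputable def roundEnd (x : ℝ) (u d : ℕ → ℝ) (j : ℕ) : ℝ :=
  ∑ i ∈ Finset.range (j + 1), roundDuration x u d i

/-- Time till absorption at the origin: the first time at which the particle reaches the origin and
is absorbed there. A visit of the origin in round `j` is absorbing if `b j` is `true`, and leads to
an upward reflection otherwise. The value is `∞` if absorption never takes place. -/
noncomputable def absorptionTime (x : ℝ) (u d : ℕ → ℝ) (b : ℕ → Bool) : ℝ≥0∞ :=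
  ⨅ (j : ℕ) (_ : ReachesOrigin x u d j ∧ b j = true), ENNReal.ofReal (roundEnd x u d j)

/-- The random ingredients of the telegraph process with an elastic boundary at the origin: i.i.d.
upward periods `U`, exponential with rate `lam`; i.i.d. downward periods `D`, exponential with rate
`mu`; i.i.d. absorption trials `B`, with absorption probability `α`; and these three sequences are
independent. -/
structure IsElasticTelegraph {Ω : Type*} [MeasurableSpace Ω] (P : Measure Ω)
    (lam mu α : ℝ) (U D : ℕ → Ω → ℝ) (B : ℕ → Ω → Bool) : Prop where
  law_up : ∀ j, HasLaw (U j) (expMeasure lam) P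
  law_down : ∀ j, HasLaw (D j) (expMeasure mu) P
  aemeasurable_trial : ∀ j, AEMeasurable (B j) P
  prob_trial : ∀ j, P {ω | B j ω = true} = ENNReal.ofReal α
  indep_up : iIndepFun U P
  indep_down : iIndepFun D P
  indep_trial : iIndepFun B P
  indep_up_down : IndepFun (fun ω j => U j ω) (fun ω j => D j ω) P
  indep_motion_trial :
    IndepFun (fun ω => ((fun j => U j ω), (fun j => D j ω))) (fun ω j => B j ω) P

end ElasticTelegraph

/-! The process observed at the starts of its rounds is a Markov chain of heights driven by i.i.d.
triples, so the moment generating function of the absorption time can be computed with an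
exponential harmonic function. Weight each round by `exp (s * duration)`. For a suitable `θ`, one
round without absorption reproduces `K * exp (θ * x)` except for a deficit equal to the weight of
the absorbing rounds (`exp_eq_lintegral_absorbWeight_add`). Telescoping gives `K` as the exponential
moment of the absorption time, provided that the survival term vanishes; this comes from a larger
exponent at which one round is a strict contraction (`tendsto_survivalMean`).

The parameters are `θ = s + mu * (ρ - 1)` and `K = ρ * (α + (1 - α) * K)`, where `ρ` is the smaller
root of `mu * ρ ^ 2 - (lam + mu - 2 * s) * ρ + lam = 0`. Probabilistically `ρ` is the transform of
one excursion from the origin, and `K` that of a geometric number of them. The root is a Catalan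
generating function, and its expansion in `s` produces the hypergeometric values
(`cycleSeries_sumsTo`).

The rest is algebra of power series. A relation linear in the transform of the absorption time and
in `ρ` gives a first-order recursion for the moments, solvable when `mu + lam * (α - 1) ≠ 0`. A
quadratic equation for the transform alone gives mean and variance without that restriction. -/

namespace ElasticTelegraph

/-! ### Catalan generating function -/

open Finset in
/-- If `1 + w * X ^ 2 ≤ X`, the partial sums of the Catalan generating function at `w` are at most
`X`. -/
theorem sum_catalan_mul_pow_le {w X : ℝ} (hw : 0 ≤ w) (hX : 1 + w * X ^ 2 ≤ X) (n : ℕ) :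
    ∑ k ∈ range n, (catalan k : ℝ) * w ^ k ≤ X := by
  have hX0 : 0 ≤ X := by nlinarith [mul_nonneg hw (sq_nonneg X)]
  induction n with
  | zero => simpa using hX0
  | succ n ih =>
    have hnn : 0 ≤ ∑ k ∈ range n, (catalan k : ℝ) * w ^ k :=
      sum_nonneg fun k _ => by positivity
    -- The antidiagonals of sum below `n` lie in the square `range n × range n`. Hence each partial
    -- sum is at most `1 + w * S ^ 2`, with `S` the previous one, and the supersolution `X` bounds
    -- them all.
    have key : ∑ k ∈ range n, (catalan (k + 1) : ℝ) * w ^ (k + 1) ≤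
        w * (∑ k ∈ range n, (catalan k : ℝ) * w ^ k) ^ 2 := by
      have h1 : ∀ k, (catalan (k + 1) : ℝ) * w ^ (k + 1) =
          w * ∑ p ∈ antidiagonal k, ((catalan p.1 : ℝ) * w ^ p.1) * (catalan p.2 * w ^ p.2) := by
        intro k
        rw [catalan_succ', mul_sum]
        push_cast
        rw [sum_mul]
        refine sum_congr rfl fun p hp => ?_
        rw [← HasAntidiagonal.mem_antidiagonal.1 hp]
        ring
      simp_rw [h1, ← mul_sum]
      refine mul_le_mul_of_nonneg_left ?_ hw
      rw [sq, sum_mul_sum, ← sum_product', sum_sigma']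
      rw [← sum_image (s := (range n).sigma fun k => antidiagonal k) (g := fun x => x.2)
        (f := fun p : ℕ × ℕ => ((catalan p.1 : ℝ) * w ^ p.1) * (catalan p.2 * w ^ p.2))]
      · refine sum_le_sum_of_subset_of_nonneg ?_ fun p _ _ => by positivity
        intro p hp
        simp only [mem_image, mem_sigma, mem_range, HasAntidiagonal.mem_antidiagonal, Sigma.exists,
          mem_product] at hp ⊢
        obtain ⟨k, q, ⟨hk, hq⟩, rfl⟩ := hp
        omega
      · rintro ⟨k, p⟩ hp ⟨l, q⟩ hq h
        simp only [coe_sigma, Set.mem_sigma_iff, mem_coe, mem_range,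
          HasAntidiagonal.mem_antidiagonal] at hp hq h
        subst h
        obtain ⟨-, rfl⟩ := hp
        obtain ⟨-, rfl⟩ := hq
        rfl
    rw [sum_range_succ']
    simp only [catalan_zero, Nat.cast_one, pow_zero, mul_one]
    have : w * (∑ k ∈ range n, (catalan k : ℝ) * w ^ k) ^ 2 ≤ w * X ^ 2 := by gcongr
    linarith

theorem summable_catalan_mul_pow {w X : ℝ} (hw : 0 ≤ w) (hX : 1 + w * X ^ 2 ≤ X) :
    Summable fun k => (catalan k : ℝ) * w ^ k :=
  summable_of_sum_range_le (fun k => by positivity) (sum_catalan_mul_pow_le hw hX)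

theorem tsum_catalan_mul_pow_le {w X : ℝ} (hw : 0 ≤ w) (hX : 1 + w * X ^ 2 ≤ X) :
    ∑' k, (catalan k : ℝ) * w ^ k ≤ X :=
  (summable_catalan_mul_pow hw hX).tsum_le_of_sum_range_le (sum_catalan_mul_pow_le hw hX)

open Finset in
theorem tsum_catalan_mul_pow_eq {w X : ℝ} (hw : 0 ≤ w) (hX : 1 + w * X ^ 2 ≤ X) :
    ∑' k, (catalan k : ℝ) * w ^ k = 1 + w * (∑' k, (catalan k : ℝ) * w ^ k) ^ 2 := by
  have hs := summable_catalan_mul_pow hw hX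
  conv_lhs => rw [hs.tsum_eq_zero_add]
  rw [sq, tsum_mul_tsum_eq_tsum_sum_antidiagonal_of_summable_norm hs.norm hs.norm, ← tsum_mul_left]
  simp only [catalan_zero, Nat.cast_one, pow_zero, mul_one]
  congr 1
  refine tsum_congr fun k => ?_
  rw [catalan_succ', mul_sum]
  push_cast
  rw [sum_mul]
  refine sum_congr rfl fun p hp => ?_
  rw [← HasAntidiagonal.mem_antidiagonal.1 hp]
  ring

/-! ### Evaluation and uniqueness of real power series -/

/-- The power series `p` converges at `x`, with sum `y`. -/
def SumsTo (p : PowerSeries ℝ) (x y : ℝ) : Prop :=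
  HasSum (fun n => PowerSeries.coeff n p * x ^ n) y

namespace SumsTo

variable {p q : PowerSeries ℝ} {x y z : ℝ}

theorem add (hp : SumsTo p x y) (hq : SumsTo q x z) : SumsTo (p + q) x (y + z) := by
  simpa [SumsTo, add_mul] using HasSum.add hp hq

theorem sub (hp : SumsTo p x y) (hq : SumsTo q x z) : SumsTo (p - q) x (y - z) := by
  simpa [SumsTo, sub_mul] using HasSum.sub hp hq

open Finset in
theorem mul (hp : SumsTo p x y) (hq : SumsTo q x z) : SumsTo (p * q) x (y * z) := by
  have h1 := HasSum.summable hp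
  have h2 := HasSum.summable hq
  have h := summable_norm_sum_mul_antidiagonal_of_summable_norm h1.norm h2.norm
  have e := tsum_mul_tsum_eq_tsum_sum_antidiagonal_of_summable_norm h1.norm h2.norm
  rw [HasSum.tsum_eq hp, HasSum.tsum_eq hq] at e
  rw [SumsTo, e]
  refine h.of_norm.hasSum.congr_fun fun n => ?_
  rw [PowerSeries.coeff_mul, sum_mul]
  refine sum_congr rfl fun r hr => ?_
  rw [← HasAntidiagonal.mem_antidiagonal.1 hr]
  ring

theorem C (a : ℝ) : SumsTo (PowerSeries.C a) x a := by
  have := hasSum_single (f := fun n => PowerSeries.coeff n (PowerSeries.C a) * x ^ n) 0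
    fun n hn => by simp [PowerSeries.coeff_C, hn]
  simpa [SumsTo] using this

theorem X : SumsTo PowerSeries.X x x := by
  have := hasSum_single (f := fun n => PowerSeries.coeff n (PowerSeries.X : PowerSeries ℝ) * x ^ n) 1
    fun n hn => by simp [PowerSeries.coeff_X, hn]
  simpa [SumsTo] using this

end SumsTo

/-- The constant coefficient is at most a fixed multiple of `x`, so it vanishes as `x` decreases to
`0`; dividing by `x` shifts the coefficients. Only positive arguments are needed. -/
theorem eq_zero_of_hasSum_zero {s : ℝ} (hs : 0 < s) (n : ℕ) : ∀ {c : ℕ → ℝ},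
    (∀ x ∈ Set.Ioo 0 s, HasSum (fun n => c n * x ^ n) 0) → c n = 0 := by
  have key : ∀ {c : ℕ → ℝ}, (∀ x ∈ Set.Ioo 0 s, HasSum (fun n => c n * x ^ n) 0) → c 0 = 0 := by
    intro c hc
    have hmem : s / 2 ∈ Set.Ioo 0 s := ⟨by linarith, by linarith⟩
    have hsum : Summable fun n => |c (n + 1)| * (s / 2) ^ n := by
      have h := ((summable_nat_add_iff 1).2 (hc _ hmem).summable).norm.mul_left (s / 2)⁻¹
      refine h.congr fun n => ?_
      rw [norm_mul, norm_pow, Real.norm_eq_abs, Real.norm_of_nonneg hmem.1.le, pow_succ]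
      have := hmem.1.ne'
      field_simp
    have hb : ∀ x ∈ Set.Ioc 0 (s / 2), |c 0| ≤ x * ∑' n, |c (n + 1)| * (s / 2) ^ n := by
      intro x hx
      have h := hc x ⟨hx.1, by linarith [hx.2]⟩
      have h0 := h.summable.tsum_eq_zero_add
      rw [h.tsum_eq] at h0
      have h1 : c 0 = -∑' n, c (n + 1) * x ^ (n + 1) := by simp at h0 ⊢; linarith
      rw [h1, abs_neg, ← tsum_mul_left]
      refine tsum_of_norm_bounded (f := fun n => c (n + 1) * x ^ (n + 1))
        (hsum.mul_left x).hasSum fun n => ?_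
      rw [norm_mul, norm_pow, Real.norm_eq_abs, Real.norm_of_nonneg hx.1.le, pow_succ]
      have : x ^ n ≤ (s / 2) ^ n := by
        gcongr
        exacts [hx.1.le, hx.2]
      nlinarith [mul_le_mul_of_nonneg_left this (mul_nonneg (abs_nonneg (c (n + 1))) hx.1.le)]
    have ht : Filter.Tendsto (fun x : ℝ => x * ∑' n, |c (n + 1)| * (s / 2) ^ n)
        (nhdsWithin 0 (Set.Ioi 0)) (nhds 0) := by
      have : Continuous fun x : ℝ => x * ∑' n, |c (n + 1)| * (s / 2) ^ n := by fun_prop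
      simpa using this.continuousWithinAt (s := Set.Ioi 0) (x := 0) |>.tendsto
    have := ge_of_tendsto ht (Filter.mem_of_superset (Ioc_mem_nhdsGT hmem.1) hb)
    exact abs_nonpos_iff.1 this
  induction n with
  | zero => exact key
  | succ n ih =>
    intro c hc
    refine ih (c := fun n => c (n + 1)) fun x hx => ?_
    have h := (hasSum_nat_add_iff' 1).2 (hc x hx)
    have h' := h.mul_left x⁻¹
    simp only [Finset.range_one, Finset.sum_singleton, key hc, zero_mul, sub_zero, mul_zero] at h'
    refine h'.congr_fun fun n => ?_
    rw [pow_succ]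
    have := hx.1.ne'
    field_simp

theorem powerSeries_eq_of_sumsTo {s : ℝ} (hs : 0 < s) {p q : PowerSeries ℝ} {f : ℝ → ℝ}
    (hp : ∀ x ∈ Set.Ioo 0 s, SumsTo p x (f x)) (hq : ∀ x ∈ Set.Ioo 0 s, SumsTo q x (f x)) :
    p = q := by
  ext n
  have := eq_zero_of_hasSum_zero hs n (c := fun n => PowerSeries.coeff n (p - q))
    fun x hx => by
      have h := (hp x hx).sub (hq x hx)
      rwa [sub_self] at h
  simpa [sub_eq_zero] using this

/-! ### Hypergeometric coefficients of the excursion transform -/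

theorem ascPochhammer_half_mul (n k : ℕ) :
    (ascPochhammer ℝ k).eval (((n : ℝ) + 1) / 2) * (ascPochhammer ℝ k).eval (((n : ℝ) + 2) / 2) *
      4 ^ k * (n ! : ℝ) = ((n + 2 * k)! : ℝ) := by
  induction k with
  | zero => simp
  | succ k ih =>
    rw [show n + 2 * (k + 1) = n + 2 * k + 1 + 1 by ring, Nat.factorial_succ, Nat.factorial_succ]
    push_cast
    rw [← ih]
    simp only [ascPochhammer_succ_eval]
    ring

theorem ascPochhammer_two (k : ℕ) : (ascPochhammer ℝ k).eval 2 = ((k + 1)! : ℝ) := by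
  induction k with
  | zero => simp
  | succ k ih =>
    rw [ascPochhammer_succ_eval, ih, Nat.factorial_succ (k + 1)]
    push_cast
    ring

theorem catalan_mul_factorial (k : ℕ) : (catalan k : ℝ) * (k ! * (k + 1)!) = ((2 * k)! : ℝ) := by
  have h := succ_mul_catalan_eq_centralBinom k
  have h2 := Nat.choose_mul_factorial_mul_factorial (n := 2 * k) (k := k) (by omega)
  rw [show 2 * k - k = k by omega, ← Nat.centralBinom_eq_two_mul_choose, ← h] at h2
  rw [← h2, Nat.factorial_succ]
  push_cast
  ring

/-- Duplication merges the two Pochhammer symbols into `(n + 2 * k)! / (n ! * 4 ^ k)`, and the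
factor `4 ^ k` is cancelled by the argument `4 * z`. -/
theorem hypergeometric_term (n k : ℕ) (z : ℝ) :
    ((k ! : ℝ)⁻¹ * (ascPochhammer ℝ k).eval (((n : ℝ) + 1) / 2) *
      (ascPochhammer ℝ k).eval (((n : ℝ) + 2) / 2) * ((ascPochhammer ℝ k).eval (2 : ℝ))⁻¹) *
        (4 * z) ^ k = catalan k * ((n + 2 * k).choose (2 * k) : ℝ) * z ^ k := by
  have h1 := ascPochhammer_half_mul n k
  have h2 := catalan_mul_factorial k
  have h3 : (((n + 2 * k).choose (2 * k) : ℕ) : ℝ) * ((2 * k)! : ℝ) * (n ! : ℝ) =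
      ((n + 2 * k)! : ℝ) := by
    have := Nat.choose_mul_factorial_mul_factorial (n := n + 2 * k) (k := 2 * k) (by omega)
    rw [show n + 2 * k - 2 * k = n by omega] at this
    exact_mod_cast this
  rw [ascPochhammer_two, mul_pow]
  have hn : (n ! : ℝ) ≠ 0 := by positivity
  have hk : (k ! : ℝ) ≠ 0 := by positivity
  have hk1 : ((k + 1)! : ℝ) ≠ 0 := by positivity
  rw [← h1, ← h2] at h3
  generalize (ascPochhammer ℝ k).eval (((n : ℝ) + 1) / 2) = a at *
  generalize (ascPochhammer ℝ k).eval (((n : ℝ) + 2) / 2) = b at *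
  field_simp
  apply mul_right_cancel₀ hn
  linear_combination -(z ^ k) * h3

/-- The power series whose `n`-th coefficient is `1 / n!` times the `n`-th moment of the time
between two consecutive visits of the origin. -/
noncomputable def cycleSeries (lam mu : ℝ) : PowerSeries ℝ :=
  PowerSeries.mk fun n => lam * 2 ^ n / (lam + mu) ^ (n + 1) *
    ordinaryHypergeometric (((n : ℝ) + 1) / 2) (((n : ℝ) + 2) / 2) (2 : ℝ)
      (4 * lam * mu / (lam + mu) ^ 2)

/-- With `r = lam + mu - 2 * s`, the root is `lam / r` times the Catalan series at `lam * mu / r ^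
2`. Expanding the powers of `1 / r` in `s` gives a nonnegative double series: its rows rebuild the
Catalan series, its columns are the hypergeometric coefficients. -/
theorem cycleSeries_sumsTo {lam mu s ε : ℝ} (hmu : 0 < mu) (hlam : 0 < lam) (hs : 0 < s)
    (hε : 0 < ε) (hsε : 2 * s * (1 + ε) < ε * (lam - mu) - mu * ε ^ 2) :
    ∃ ρ, SumsTo (cycleSeries lam mu) s ρ ∧ mu * ρ ^ 2 - (lam + mu - 2 * s) * ρ + lam = 0 ∧
      0 < ρ ∧ ρ ≤ 1 + ε := by
  set R := lam + mu with hR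
  have hR0 : 0 < R := by positivity
  -- The hypothesis `hsε` says exactly that the quadratic in `ρ` is negative at `1 + ε`. Rescaled by
  -- `r / lam`, the point `1 + ε` becomes the supersolution `Y`.
  have hsup : lam + mu * (1 + ε) ^ 2 ≤ (R - 2 * s) * (1 + ε) := by rw [hR]; nlinarith
  have hr : 0 < R - 2 * s := by
    by_contra h
    push Not at h
    nlinarith [mul_nonneg hmu.le (sq_nonneg (1 + ε)),
      mul_nonneg (neg_nonneg.2 h) (by linarith : 0 ≤ 1 + ε)]
  set r := R - 2 * s with hrdef
  set w := lam * mu / r ^ 2 with hw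
  have hw0 : 0 ≤ w := by positivity
  set Y := r * (1 + ε) / lam with hY
  have hX : 1 + w * Y ^ 2 ≤ Y := by
    have : 1 + w * Y ^ 2 = (lam + mu * (1 + ε) ^ 2) / lam := by
      rw [hw, hY]; field_simp
    rw [this, hY]
    gcongr
  have hsum := summable_catalan_mul_pow hw0 hX
  have hle := tsum_catalan_mul_pow_le hw0 hX
  have heq := tsum_catalan_mul_pow_eq hw0 hX
  set Φ := ∑' k, (catalan k : ℝ) * w ^ k with hΦ
  have hΦ0 : 0 < Φ := by rw [heq]; positivity
  refine ⟨lam / r * Φ, ?_, ?_, by positivity, ?_⟩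
  · set f : ℕ × ℕ → ℝ := fun p =>
      lam / R * (lam * mu / R ^ 2) ^ p.1 * catalan p.1 *
        (((p.2 + 2 * p.1).choose (2 * p.1) : ℝ) * (2 * s / R) ^ p.2) with hf
    have hf0 : 0 ≤ f := fun p => by rw [hf]; positivity
    have hnorm : ‖2 * s / R‖ < 1 := by
      rw [Real.norm_of_nonneg (by positivity), div_lt_one hR0]; linarith
    have hrow : ∀ k, HasSum (fun n => f (k, n)) (lam / r * (catalan k * w ^ k)) := by
      intro k
      have h := (hasSum_choose_mul_geometric_of_norm_lt_one (2 * k) hnorm).mul_left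
        (lam / R * (lam * mu / R ^ 2) ^ k * catalan k)
      have e : lam / R * (lam * mu / R ^ 2) ^ k * catalan k * (1 / (1 - 2 * s / R) ^ (2 * k + 1)) =
          lam / r * (catalan k * w ^ k) := by
        have : 1 - 2 * s / R = r / R := by rw [hrdef]; field_simp
        rw [this, hw, pow_succ _ (2 * k), pow_mul, div_pow (lam * mu) (r ^ 2),
          div_pow (lam * mu) (R ^ 2), div_pow r R 2, div_pow (r ^ 2) (R ^ 2)]
        field_simp
      rw [← e]
      exact h
    have hfsum : Summable f := by
      refine (summable_prod_of_nonneg hf0).2 ⟨fun k => (hrow k).summable, ?_⟩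
      refine ((hsum.mul_left (lam / r)).congr fun k => ?_)
      exact (hrow k).tsum_eq.symm
    have htot : HasSum f (lam / r * Φ) := by
      have h := hfsum.hasSum.prod_fiberwise hrow
      rw [← h.unique (hsum.hasSum.mul_left (lam / r))]
      exact hfsum.hasSum
    have hswap : HasSum (f ∘ Prod.swap) (lam / r * Φ) :=
      (Equiv.prodComm ℕ ℕ).hasSum_iff.2 htot
    have hcol : ∀ n, HasSum (fun k => f (k, n))
        (PowerSeries.coeff n (cycleSeries lam mu) * s ^ n) := by
      intro n
      have h1 : Summable fun k => f (k, n) := hswap.summable.prod_factor n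
      convert h1.hasSum using 1
      rw [cycleSeries, PowerSeries.coeff_mk, ordinaryHypergeometric_eq_tsum, ← tsum_mul_left,
        ← tsum_mul_right]
      refine tsum_congr fun k => ?_
      have := hypergeometric_term n k (lam * mu / R ^ 2)
      rw [smul_eq_mul, ← hR, show 4 * lam * mu / R ^ 2 = 4 * (lam * mu / R ^ 2) by ring, this, hf]
      simp only [div_pow, mul_pow, pow_succ]
      field_simp
    exact hswap.prod_fiberwise hcol
  · have : mu * (lam / r * Φ) ^ 2 - r * (lam / r * Φ) + lam =
        lam * (1 + w * Φ ^ 2 - Φ) := by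
      rw [hw]; field_simp
      ring
    rw [this, ← heq]
    ring
  · rw [hY] at hle
    calc lam / r * Φ ≤ lam / r * (r * (1 + ε) / lam) := by gcongr
      _ = 1 + ε := by field_simp

/-! ### Algebraic relations and extraction of coefficients -/

/-- The values of the power series `A` near the origin are those of the moment generating function
of a geometric number of independent cycles. -/
def IsGeometricCompound (lam mu α : ℝ) (A : PowerSeries ℝ) (s₀ : ℝ) : Prop :=
  ∀ s ∈ Set.Ioo 0 s₀, ∃ ρ K, SumsTo (cycleSeries lam mu) s ρ ∧
    mu * ρ ^ 2 - (lam + mu - 2 * s) * ρ + lam = 0 ∧ 0 < ρ ∧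
    K = ρ * (α + (1 - α) * K) ∧ SumsTo A s K

variable {lam mu α s₀ : ℝ} {A : PowerSeries ℝ}

-- Modulo the quadratic for `ρ`, the product `(1 - (1 - α) * ρ) * (mu * ρ - (1 - α) * lam)` is a
-- multiple of `ρ` by a factor affine in `s`. This rationalises `K = α * ρ / (1 - (1 - α) * ρ)`.
open PowerSeries in
theorem IsGeometricCompound.linear_relation (h : IsGeometricCompound lam mu α A s₀)
    (hs₀ : 0 < s₀) (hα : 0 < α) :
    (C (α * (mu + lam * (α - 1))) + C (2 * (1 - α)) * X) * A =
      C α * (C mu * cycleSeries lam mu - C ((1 - α) * lam)) := by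
  choose! ρ K h1 h2 h3 h4 h5 using h
  refine powerSeries_eq_of_sumsTo hs₀ (f := fun s =>
    (α * (mu + lam * (α - 1)) + 2 * (1 - α) * s) * K s) (fun s hs => ?_) fun s hs => ?_
  · exact ((SumsTo.C _).add ((SumsTo.C _).mul SumsTo.X)).mul (h5 s hs)
  · have e : (α * (mu + lam * (α - 1)) + 2 * (1 - α) * s) * K s =
        α * (mu * ρ s - (1 - α) * lam) := by
      have k : K s * (1 - (1 - α) * ρ s) = α * ρ s := by linear_combination h4 s hs
      have h0 : 1 - (1 - α) * ρ s ≠ 0 := by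
        intro h0
        rw [h0, mul_zero] at k
        exact (mul_pos hα (h3 s hs)).ne k
      apply mul_right_cancel₀ h0
      linear_combination (α * (mu + lam * (α - 1)) + 2 * (1 - α) * s) * k +
        α * (1 - α) * h2 s hs
    rw [e]
    exact (SumsTo.C _).mul (((SumsTo.C _).mul (h1 s hs)).sub (SumsTo.C _))

open PowerSeries in
theorem coeff_succ_of_quadratic {p q t r w : ℝ}
    (h : C p * (A * A) + C q * A + C t + (C r * A + C w * (A * A)) * X = 0) (n : ℕ) :
    p * coeff (n + 1) (A * A) + q * coeff (n + 1) A + (r * coeff n A + w * coeff n (A * A)) = 0 := by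
  have e := congrArg (coeff (n + 1)) h
  simpa only [map_add, coeff_C_mul, coeff_succ_mul_X, coeff_C, map_zero, Nat.succ_ne_zero, if_false,
    add_zero] using e

-- Put `y = α + (1 - α) * K`, so that `K = ρ * y`; multiplying the quadratic for `ρ` by `y ^ 2`
-- eliminates `ρ`.
open PowerSeries in
theorem IsGeometricCompound.quadratic_relation (h : IsGeometricCompound lam mu α A s₀)
    (hs₀ : 0 < s₀) :
    C (mu - (lam + mu) * (1 - α) + lam * (1 - α) ^ 2) * (A * A) +
      C (2 * lam * α * (1 - α) - (lam + mu) * α) * A + C (lam * α ^ 2) +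
      (C (2 * α) * A + C (2 * (1 - α)) * (A * A)) * X = 0 := by
  choose! ρ K h1 h2 h3 h4 h5 using h
  refine powerSeries_eq_of_sumsTo hs₀ (f := fun _ => 0) (fun s hs => ?_) fun s hs => ?_
  · have e : 0 = (mu - (lam + mu) * (1 - α) + lam * (1 - α) ^ 2) * (K s * K s) +
        (2 * lam * α * (1 - α) - (lam + mu) * α) * K s + lam * α ^ 2 +
        (2 * α * K s + 2 * (1 - α) * (K s * K s)) * s := by
      generalize hy : α + (1 - α) * K s = y at *
      have e1 := h4 s hs
      rw [hy] at e1
      have e2 : mu * K s ^ 2 - (lam + mu - 2 * s) * K s * y + lam * y ^ 2 = 0 := by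
        rw [e1]
        linear_combination y ^ 2 * h2 s hs
      rw [← hy] at e2
      linear_combination -e2
    have hA := h5 s hs
    have hAA := hA.mul hA
    rw [e]
    exact ((((SumsTo.C _).mul hAA).add ((SumsTo.C _).mul hA)).add (SumsTo.C _)).add
      ((((SumsTo.C _).mul hA).add ((SumsTo.C _).mul hAA)).mul SumsTo.X)
  · simpa using SumsTo.C (x := s) 0

/-- At constant term `1` the quadratic linearises with slope `-α * (lam - mu)`, which is nonzero
even if `mu + lam * (α - 1) = 0`. -/
theorem IsGeometricCompound.coeff_one (h : IsGeometricCompound lam mu α A s₀)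
    (hs₀ : 0 < s₀) (hα : 0 < α) (hlam : mu < lam) (h0 : PowerSeries.coeff 0 A = 1) :
    PowerSeries.coeff 1 A = 2 / (α * (lam - mu)) := by
  have e := coeff_succ_of_quadratic (h.quadratic_relation hs₀) 0
  have hA2 : PowerSeries.coeff 1 (A * A) = 2 * PowerSeries.coeff 1 A := by
    rw [PowerSeries.coeff_mul, show Finset.HasAntidiagonal.antidiagonal 1 = {(0, 1), (1, 0)} from rfl]
    simp [h0]; ring
  have hA0 : PowerSeries.coeff 0 (A * A) = 1 := by
    rw [PowerSeries.coeff_mul, show Finset.HasAntidiagonal.antidiagonal 0 = {(0, 0)} from rfl]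
    simp [h0]
  simp only [zero_add, hA0, h0, hA2] at e
  have : lam - mu ≠ 0 := by linarith
  rw [eq_div_iff (by positivity)]
  linear_combination -e

theorem IsGeometricCompound.coeff_two (h : IsGeometricCompound lam mu α A s₀)
    (hs₀ : 0 < s₀) (hα : 0 < α) (hlam : mu < lam) (h0 : PowerSeries.coeff 0 A = 1) :
    2 * PowerSeries.coeff 2 A - PowerSeries.coeff 1 A ^ 2 =
      4 * (lam + mu * (2 * α - 1)) / (α ^ 2 * (lam - mu) ^ 3) := by
  have e := coeff_succ_of_quadratic (h.quadratic_relation hs₀) 1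
  have e1 := h.coeff_one hs₀ hα hlam h0
  have hA2 : PowerSeries.coeff 2 (A * A) =
      2 * PowerSeries.coeff 2 A + PowerSeries.coeff 1 A ^ 2 := by
    rw [PowerSeries.coeff_mul, show Finset.HasAntidiagonal.antidiagonal 2 = {(0, 2), (1, 1), (2, 0)} from rfl]
    simp [h0]; ring
  have hA1 : PowerSeries.coeff 1 (A * A) = 2 * PowerSeries.coeff 1 A := by
    rw [PowerSeries.coeff_mul, show Finset.HasAntidiagonal.antidiagonal 1 = {(0, 1), (1, 0)} from rfl]
    simp [h0]; ring
  simp only [Nat.reduceAdd, hA2, hA1, e1] at e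
  rw [e1]
  have hd : lam - mu ≠ 0 := by linarith
  generalize PowerSeries.coeff 2 A = a at *
  have e3 : α * (lam - mu) * a = (mu - (lam + mu) * (1 - α) + lam * (1 - α) ^ 2) *
      (2 / (α * (lam - mu))) ^ 2 + 2 * α * (2 / (α * (lam - mu))) +
      2 * (1 - α) * (2 * (2 / (α * (lam - mu)))) := by linear_combination -e
  have e4 : a = ((mu - (lam + mu) * (1 - α) + lam * (1 - α) ^ 2) *
      (2 / (α * (lam - mu))) ^ 2 + 2 * α * (2 / (α * (lam - mu))) +
      2 * (1 - α) * (2 * (2 / (α * (lam - mu))))) / (α * (lam - mu)) := by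
    rw [eq_div_iff (by positivity)]; linear_combination e3
  rw [e4]
  field_simp
  ring

/-- Solves the first-order recursion of `linear_relation`. Its ratio `2 * (α - 1) / (α * m)` is `8 *
lam * (α - 1)` over `4 * lam * α * m`, whence the two bases in the formula. -/
theorem IsGeometricCompound.coeff_eq (h : IsGeometricCompound lam mu α A s₀)
    (hs₀ : 0 < s₀) (hα : 0 < α) (hmu : 0 < mu) (hlam : mu < lam) (h0 : PowerSeries.coeff 0 A = 1)
    (hm : mu + lam * (α - 1) ≠ 0) (n : ℕ) :
    PowerSeries.coeff n A =
      2 * α * lam / (4 * lam * α * (mu + lam * (α - 1))) ^ (n + 1) *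
        ((2 * mu + 2 * lam * (α - 1)) * (8 * lam * (α - 1)) ^ n +
          ∑ h ∈ Finset.Icc 1 n,
            (4 * lam * α * (mu + lam * (α - 1))) ^ h * (8 * lam * (α - 1)) ^ (n - h) *
              (lam * mu * 2 ^ (h + 1) / (lam + mu) ^ (h + 1)) *
              ordinaryHypergeometric (((h : ℝ) + 1) / 2) (((h : ℝ) + 2) / 2) (2 : ℝ)
                (4 * lam * mu / (lam + mu) ^ 2)) := by
  have hlam0 : lam ≠ 0 := by linarith
  set m := mu + lam * (α - 1) with hmdef
  induction n with
  | zero =>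
    rw [h0]
    simp only [zero_add, pow_one, pow_zero, mul_one, Finset.Icc_eq_empty_of_lt zero_lt_one,
      Finset.sum_empty, add_zero]
    rw [show 2 * mu + 2 * lam * (α - 1) = 2 * m by rw [hmdef]; ring]
    field_simp
    norm_num
  | succ n ih =>
    have e := congrArg (PowerSeries.coeff (n + 1)) (h.linear_relation hs₀ hα)
    rw [add_mul, mul_assoc, mul_comm PowerSeries.X] at e
    simp only [map_add, map_sub, PowerSeries.coeff_C_mul, PowerSeries.coeff_succ_mul_X,
      PowerSeries.coeff_C, Nat.succ_ne_zero, if_false, sub_zero] at e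
    rw [cycleSeries, PowerSeries.coeff_mk] at e
    have e' : PowerSeries.coeff (n + 1) A = (2 * (α - 1)) / (α * m) * PowerSeries.coeff n A +
        mu / m * (lam * 2 ^ (n + 1) / (lam + mu) ^ (n + 1 + 1) *
          ordinaryHypergeometric ((((n + 1 : ℕ) : ℝ) + 1) / 2) ((((n + 1 : ℕ) : ℝ) + 2) / 2) (2 : ℝ)
            (4 * lam * mu / (lam + mu) ^ 2)) := by
      rw [← hmdef] at e
      clear_value m
      generalize ordinaryHypergeometric ((((n + 1 : ℕ) : ℝ) + 1) / 2) ((((n + 1 : ℕ) : ℝ) + 2) / 2)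
        (2 : ℝ) (4 * lam * mu / (lam + mu) ^ 2) = F at e ⊢
      have : α * m ≠ 0 := by positivity
      apply mul_left_cancel₀ this
      field_simp
      linear_combination e
    have hS : ∑ h ∈ Finset.Icc 1 n,
        (4 * lam * α * m) ^ h * (8 * lam * (α - 1)) ^ (n + 1 - h) *
          (lam * mu * 2 ^ (h + 1) / (lam + mu) ^ (h + 1)) *
          ordinaryHypergeometric (((h : ℝ) + 1) / 2) (((h : ℝ) + 2) / 2) (2 : ℝ)
            (4 * lam * mu / (lam + mu) ^ 2) =
        8 * lam * (α - 1) * ∑ h ∈ Finset.Icc 1 n,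
          (4 * lam * α * m) ^ h * (8 * lam * (α - 1)) ^ (n - h) *
            (lam * mu * 2 ^ (h + 1) / (lam + mu) ^ (h + 1)) *
            ordinaryHypergeometric (((h : ℝ) + 1) / 2) (((h : ℝ) + 2) / 2) (2 : ℝ)
              (4 * lam * mu / (lam + mu) ^ 2) := by
      rw [Finset.mul_sum]
      refine Finset.sum_congr rfl fun k hk => ?_
      rw [Nat.sub_add_comm (Finset.mem_Icc.1 hk).2, pow_succ]
      ring
    rw [e', ih, Finset.sum_Icc_succ_top (by omega), hS]
    clear e e' ih hS
    generalize ordinaryHypergeometric ((((n + 1 : ℕ) : ℝ) + 1) / 2) ((((n + 1 : ℕ) : ℝ) + 2) / 2)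
      (2 : ℝ) (4 * lam * mu / (lam + mu) ^ 2) = F
    rw [Nat.sub_self]
    generalize (∑ h ∈ Finset.Icc 1 n, _ : ℝ) = S
    have hR : lam + mu ≠ 0 := by linarith
    rw [pow_succ (8 * lam * (α - 1)) n]
    generalize (8 * lam * (α - 1)) ^ n = Z
    rw [pow_succ (4 * lam * α * m) (n + 1)]
    have hP : (4 * lam * α * m) ^ (n + 1) ≠ 0 := by positivity
    generalize (4 * lam * α * m) ^ (n + 1) = Q at *
    generalize (lam + mu) = R at *
    field_simp
    ring

/-! ### Exponential integrals over one round -/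

theorem lintegral_expMeasure {r : ℝ} {f : ℝ → ℝ≥0∞} (hf : Measurable f) :
    ∫⁻ x, f x ∂expMeasure r = ∫⁻ x in Set.Ioi 0, ENNReal.ofReal (r * Real.exp (-(r * x))) * f x := by
  have hm : Measurable (exponentialPDF r) := (measurable_exponentialPDFReal r).ennreal_ofReal
  have e : expMeasure r = volume.withDensity (exponentialPDF r) := rfl
  rw [e, lintegral_withDensity_eq_lintegral_mul _ hm hf, ← setLIntegral_congr Ioi_ae_eq_Ici.symm,
    ← lintegral_indicator measurableSet_Ici]
  refine lintegral_congr fun x => ?_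
  by_cases hx : 0 ≤ x
  · rw [Set.indicator_of_mem (Set.mem_Ici.2 hx), Pi.mul_apply, exponentialPDF_of_nonneg hx]
  · rw [Set.indicator_of_notMem (by simpa using hx), Pi.mul_apply,
      exponentialPDF_of_neg (not_le.1 hx), zero_mul]

theorem ae_pos_expMeasure (r : ℝ) : ∀ᵐ x ∂expMeasure r, 0 < x := by
  have h : MeasurableSet {x : ℝ | ¬ 0 < x} := by measurability
  rw [ae_iff, ← lintegral_indicator_one h, lintegral_expMeasure (measurable_one.indicator h)]
  rw [setLIntegral_congr_fun measurableSet_Ioi (g := fun _ => 0)]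
  · simp
  · intro x hx
    simp [Set.mem_Ioi.1 hx]

theorem lintegral_expMeasure_tail {r a y : ℝ} (hr : 0 < r) (ha : a < r) (hy : 0 ≤ y) (b : ℝ) :
    ∫⁻ x, (if y ≤ x then ENNReal.ofReal (Real.exp (a * x + b)) else 0) ∂expMeasure r =
      ENNReal.ofReal (r / (r - a) * Real.exp (b - (r - a) * y)) := by
  have hm : Measurable fun x => if y ≤ x then ENNReal.ofReal (Real.exp (a * x + b)) else 0 :=
    Measurable.ite measurableSet_Ici (by fun_prop) measurable_const
  have hint : IntegrableOn (fun x => r * Real.exp b * Real.exp ((a - r) * x)) (Set.Ioi y) :=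
    (integrableOn_exp_mul_Ioi (by linarith) y).const_mul _
  have e : r / (r - a) * Real.exp (b - (r - a) * y) =
      ∫ x in Set.Ioi y, r * Real.exp b * Real.exp ((a - r) * x) := by
    rw [integral_const_mul, integral_exp_mul_Ioi (by linarith), sub_eq_add_neg b, Real.exp_add]
    have h1 : r - a ≠ 0 := by linarith
    have h2 : a - r ≠ 0 := by linarith
    rw [show -((r - a) * y) = (a - r) * y by ring]
    field_simp
    ring
  rw [lintegral_expMeasure hm, e, ofReal_integral_eq_lintegral_ofReal hint
    (.of_forall fun x => by positivity), setLIntegral_congr Ioi_ae_eq_Ici,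
    ← lintegral_indicator measurableSet_Ioi, ← lintegral_indicator measurableSet_Ici]
  have h0 : ∀ᵐ x : ℝ, x ≠ y := by simp [ae_iff]
  refine lintegral_congr_ae ?_
  filter_upwards [h0] with x hx
  rcases lt_or_gt_of_ne hx with hxy | hxy
  · rw [Set.indicator_of_notMem (s := Set.Ioi y) (by simpa using hxy.le)]
    simp [hxy.not_ge]
  · rw [Set.indicator_of_mem (s := Set.Ioi y) hxy,
      Set.indicator_of_mem (Set.mem_Ici.2 (hy.trans hxy.le)), if_pos hxy.le,
      ← ENNReal.ofReal_mul (by positivity), mul_assoc, mul_assoc, ← Real.exp_add, ← Real.exp_add]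
    ring_nf

theorem lintegral_expMeasure_exp {r a : ℝ} (hr : 0 < r) (ha : a < r) (b : ℝ) :
    ∫⁻ x, ENNReal.ofReal (Real.exp (a * x + b)) ∂expMeasure r =
      ENNReal.ofReal (r / (r - a) * Real.exp b) := by
  have h := lintegral_expMeasure_tail hr ha le_rfl b
  rw [mul_zero, sub_zero] at h
  rw [← h]
  refine lintegral_congr_ae ?_
  filter_upwards [ae_pos_expMeasure r] with x hx
  rw [if_pos hx.le]

theorem lintegral_expMeasure_head_add {r a y : ℝ} (hr : 0 < r) (ha : a < r) (hy : 0 ≤ y) (b : ℝ) :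
    ∫⁻ x, (if y ≤ x then 0 else ENNReal.ofReal (Real.exp (a * x + b))) ∂expMeasure r +
      ENNReal.ofReal (r / (r - a) * Real.exp (b - (r - a) * y)) =
      ENNReal.ofReal (r / (r - a) * Real.exp b) := by
  rw [← lintegral_expMeasure_tail hr ha hy, ← lintegral_expMeasure_exp hr ha,
    ← lintegral_add_right]
  · refine lintegral_congr fun x => ?_
    split_ifs <;> simp
  · exact Measurable.ite measurableSet_Ici (by fun_prop) measurable_const

/-- Contribution of the rounds that reach the origin. -/
noncomputable def reachWeight (s x : ℝ) (e : ℝ × ℝ) : ℝ≥0∞ :=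
  if x + e.1 ≤ e.2 then ENNReal.ofReal (Real.exp (s * (e.1 + min e.2 (x + e.1)))) else 0

/-- Contribution of the rounds that do not reach the origin. -/
noncomputable def missWeight (s x : ℝ) (v : ℝ → ℝ≥0∞) (e : ℝ × ℝ) : ℝ≥0∞ :=
  if x + e.1 ≤ e.2 then 0 else
    ENNReal.ofReal (Real.exp (s * (e.1 + min e.2 (x + e.1)))) * v (max (x + e.1 - e.2) 0)

theorem measurable_reachWeight (s : ℝ) :
    Measurable fun p : ℝ × (ℝ × ℝ) => reachWeight s p.1 p.2 :=
  Measurable.ite (measurableSet_le (by fun_prop) (by fun_prop)) (by fun_prop) measurable_const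

theorem measurable_missWeight (s : ℝ) {v : ℝ → ℝ≥0∞} (hv : Measurable v) :
    Measurable fun p : ℝ × (ℝ × ℝ) => missWeight s p.1 v p.2 :=
  Measurable.ite (measurableSet_le (by fun_prop) (by fun_prop)) measurable_const
    (Measurable.mul (by fun_prop) (hv.comp (by fun_prop)))

theorem measurable_reachWeight_right (s x : ℝ) : Measurable (reachWeight s x) :=
  (measurable_reachWeight s).comp measurable_prodMk_left

theorem measurable_missWeight_right (s x : ℝ) {v : ℝ → ℝ≥0∞} (hv : Measurable v) :
    Measurable (missWeight s x v) :=
  (measurable_missWeight s hv).comp measurable_prodMk_left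

variable {lam mu s θ x : ℝ}

theorem lintegral_reachWeight (hlam : 0 < lam) (hmu : 0 < mu) (hs : 2 * s < lam + mu)
    (hx : 0 ≤ x) :
    ∫⁻ e, reachWeight s x e ∂(expMeasure lam).prod (expMeasure mu) =
      ENNReal.ofReal (lam / (lam + mu - 2 * s) * Real.exp ((s - mu) * x)) := by
  have := isProbabilityMeasure_expMeasure hmu
  rw [lintegral_prod _ (measurable_reachWeight_right s x).aemeasurable]
  have e : lam + mu - 2 * s = lam - (2 * s - mu) := by ring
  rw [e, ← lintegral_expMeasure_exp hlam (by linarith)]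
  refine lintegral_congr_ae ?_
  filter_upwards [ae_pos_expMeasure lam] with u hu
  have h := lintegral_expMeasure_tail hmu hmu (y := x + u) (by linarith) (s * (u + (x + u)))
  rw [sub_zero, div_self hmu.ne', one_mul] at h
  convert h using 1
  · refine lintegral_congr fun d => ?_
    rw [reachWeight]
    split_ifs with hd
    · simp only [min_eq_right hd, zero_mul, zero_add]
    · rfl
  · congr 2
    ring

/-- If the downward motion were allowed to pass below the origin, the integral would factor. The
part with `x + u ≤ d` is `mu / (mu - s + θ)` times the mean of `reachWeight`; it is added on the
left to avoid truncated subtraction. -/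
theorem lintegral_missWeight_add (hlam : 0 < lam) (hmu : 0 < mu) (hsθ : s - θ < mu)
    (hsθ' : s + θ < lam) (hx : 0 ≤ x) :
    ∫⁻ e, missWeight s x (fun y => ENNReal.ofReal (Real.exp (θ * y))) e
        ∂(expMeasure lam).prod (expMeasure mu) +
      ENNReal.ofReal (mu / (mu - s + θ) * (lam / (lam + mu - 2 * s)) * Real.exp ((s - mu) * x)) =
      ENNReal.ofReal (mu / (mu - s + θ) * (lam / (lam - s - θ)) * Real.exp (θ * x)) := by
  have := isProbabilityMeasure_expMeasure hmu
  have hκ : 0 ≤ mu / (mu - s + θ) := div_nonneg hmu.le (by linarith)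
  rw [lintegral_prod _ (measurable_missWeight_right s x (by fun_prop)).aemeasurable]
  have e1 : lam + mu - 2 * s = lam - (2 * s - mu) := by ring
  have e2 : lam - s - θ = lam - (s + θ) := by ring
  rw [mul_assoc, mul_assoc, ENNReal.ofReal_mul hκ, ENNReal.ofReal_mul hκ, e1, e2,
    ← lintegral_expMeasure_exp hlam (by linarith), ← lintegral_expMeasure_exp hlam (by linarith),
    ← lintegral_const_mul _ (by fun_prop), ← lintegral_const_mul _ (by fun_prop),
    ← lintegral_add_right _ (by fun_prop)]
  refine lintegral_congr_ae ?_
  filter_upwards [ae_pos_expMeasure lam] with u hu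
  have h := lintegral_expMeasure_head_add hmu hsθ (y := x + u) (by linarith)
    ((s + θ) * u + θ * x)
  rw [← ENNReal.ofReal_mul hκ, ← ENNReal.ofReal_mul hκ]
  convert h using 2
  · refine lintegral_congr fun d => ?_
    rw [missWeight]
    split_ifs with hd
    · rfl
    · push Not at hd
      rw [min_eq_left hd.le, max_eq_left (by linarith), ← ENNReal.ofReal_mul (by positivity),
        ← Real.exp_add]
      congr 2
      ring
  · congr 2 <;> ring_nf
  · congr 2; ring

/-! ### One round with its absorption trial -/

/-- The law of an absorption trial. -/
noncomputable def trialMeasure (α : ℝ) : Measure Bool :=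
  ENNReal.ofReal α • Measure.dirac true + ENNReal.ofReal (1 - α) • Measure.dirac false

theorem lintegral_trialMeasure (α : ℝ) (f : Bool → ℝ≥0∞) :
    ∫⁻ b, f b ∂trialMeasure α = ENNReal.ofReal α * f true + ENNReal.ofReal (1 - α) * f false := by
  rw [trialMeasure, lintegral_add_measure, lintegral_smul_measure, lintegral_smul_measure,
    lintegral_dirac, lintegral_dirac]
  rfl

theorem ofReal_add_ofReal_one_sub {α : ℝ} (hα₀ : 0 ≤ α) (hα₁ : α ≤ 1) :
    ENNReal.ofReal α + ENNReal.ofReal (1 - α) = 1 := by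
  rw [← ENNReal.ofReal_add hα₀ (by linarith)]
  simp

theorem isProbabilityMeasure_trialMeasure {α : ℝ} (hα₀ : 0 ≤ α) (hα₁ : α ≤ 1) :
    IsProbabilityMeasure (trialMeasure α) := by
  refine ⟨?_⟩
  rw [← lintegral_one, lintegral_trialMeasure, mul_one, mul_one, ofReal_add_ofReal_one_sub hα₀ hα₁]

/-- The law of the upward period, the downward period and the absorption trial of a round. -/
noncomputable def roundMeasure (lam mu α : ℝ) : Measure ((ℝ × ℝ) × Bool) :=
  ((expMeasure lam).prod (expMeasure mu)).prod (trialMeasure α)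

/-- Absorption takes place in the round `e`, started at height `x`. -/
def Absorbs (x : ℝ) (e : (ℝ × ℝ) × Bool) : Prop := x + e.1.1 ≤ e.1.2 ∧ e.2 = true

/-- Exponential weight of a round that ends with absorption. -/
noncomputable def absorbWeight (s x : ℝ) (e : (ℝ × ℝ) × Bool) : ℝ≥0∞ :=
  open Classical in
  if Absorbs x e then ENNReal.ofReal (Real.exp (s * (e.1.1 + min e.1.2 (x + e.1.1)))) else 0

/-- Exponential weight of a round that does not end with absorption, times the value of `v` at the
height at its end. -/
noncomputable def continueWeight (s x : ℝ) (v : ℝ → ℝ≥0∞) (e : (ℝ × ℝ) × Bool) : ℝ≥0∞ :=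
  open Classical in
  if Absorbs x e then 0 else
    ENNReal.ofReal (Real.exp (s * (e.1.1 + min e.1.2 (x + e.1.1)))) * v (max (x + e.1.1 - e.1.2) 0)

theorem measurableSet_absorbs :
    MeasurableSet {p : ℝ × ((ℝ × ℝ) × Bool) | Absorbs p.1 p.2} := by
  have h1 : MeasurableSet {p : ℝ × ((ℝ × ℝ) × Bool) | p.1 + p.2.1.1 ≤ p.2.1.2} :=
    measurableSet_le (by fun_prop) (by fun_prop)
  have h2 : MeasurableSet {p : ℝ × ((ℝ × ℝ) × Bool) | p.2.2 = true} :=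
    measurableSet_eq_fun (by fun_prop) measurable_const
  exact h1.inter h2

theorem measurable_absorbWeight (s : ℝ) :
    Measurable fun p : ℝ × ((ℝ × ℝ) × Bool) => absorbWeight s p.1 p.2 := by
  classical
  exact Measurable.ite measurableSet_absorbs (by fun_prop) measurable_const

theorem measurable_continueWeight (s : ℝ) {v : ℝ → ℝ≥0∞} (hv : Measurable v) :
    Measurable fun p : ℝ × ((ℝ × ℝ) × Bool) => continueWeight s p.1 v p.2 := by
  classical
  exact Measurable.ite measurableSet_absorbs measurable_const
    (Measurable.mul (by fun_prop) (hv.comp (by fun_prop)))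

theorem measurable_absorbWeight_right (s x : ℝ) : Measurable (absorbWeight s x) :=
  (measurable_absorbWeight s).comp measurable_prodMk_left

theorem measurable_continueWeight_right (s x : ℝ) {v : ℝ → ℝ≥0∞} (hv : Measurable v) :
    Measurable (continueWeight s x v) :=
  (measurable_continueWeight s hv).comp measurable_prodMk_left

variable {α : ℝ}

theorem lintegral_absorbWeight (hα₀ : 0 ≤ α) (hα₁ : α ≤ 1)
    (s x : ℝ) :
    ∫⁻ e, absorbWeight s x e ∂roundMeasure lam mu α =
      ENNReal.ofReal α * ∫⁻ e, reachWeight s x e ∂(expMeasure lam).prod (expMeasure mu) := by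
  have := isProbabilityMeasure_trialMeasure hα₀ hα₁
  rw [roundMeasure, lintegral_prod _ (measurable_absorbWeight_right s x).aemeasurable,
    ← lintegral_const_mul _
    (measurable_reachWeight_right s x)]
  refine lintegral_congr fun e => ?_
  rw [lintegral_trialMeasure]
  simp [absorbWeight, reachWeight, Absorbs]

theorem lintegral_continueWeight (hα₀ : 0 ≤ α) (hα₁ : α ≤ 1)
    (s x : ℝ) {v : ℝ → ℝ≥0∞} (hv : Measurable v) :
    ∫⁻ e, continueWeight s x v e ∂roundMeasure lam mu α =
      ENNReal.ofReal (1 - α) * v 0 *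
        ∫⁻ e, reachWeight s x e ∂(expMeasure lam).prod (expMeasure mu) +
      ∫⁻ e, missWeight s x v e ∂(expMeasure lam).prod (expMeasure mu) := by
  have := isProbabilityMeasure_trialMeasure hα₀ hα₁
  have hr := measurable_reachWeight_right s x
  rw [roundMeasure, lintegral_prod _ (measurable_continueWeight_right s x hv).aemeasurable,
    ← lintegral_const_mul _ hr, ← lintegral_add_left
    (hr.const_mul _)]
  refine lintegral_congr fun e => ?_
  rw [lintegral_trialMeasure]
  simp only [continueWeight, reachWeight, Absorbs, missWeight]
  by_cases h : x + e.1 ≤ e.2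
  · simp only [h, and_true, if_true, Bool.false_eq_true, and_false, if_false, mul_zero, zero_add,
      add_zero, max_eq_right (sub_nonpos.2 h)]
    ring
  · simp only [h, false_and, if_false, mul_zero, zero_add, ← add_mul,
      ofReal_add_ofReal_one_sub hα₀ hα₁, one_mul]

variable {lam mu s θ x α K : ℝ}

/-- Reflection puts back `1 - α` times the reaching weight, which by `hα` does not exceed the part
cut off below the origin. -/
theorem lintegral_continueWeight_exp_le (hlam : 0 < lam) (hmu : 0 < mu) (hα₀ : 0 ≤ α)
    (hα₁ : α ≤ 1) (hsθ : s - θ < mu) (hsθ' : s + θ < lam) (hα : 1 - α ≤ mu / (mu - s + θ))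
    (hx : 0 ≤ x) :
    ∫⁻ e, continueWeight s x (fun y => ENNReal.ofReal (Real.exp (θ * y))) e
        ∂roundMeasure lam mu α ≤
      ENNReal.ofReal (mu / (mu - s + θ) * (lam / (lam - s - θ))) *
        ENNReal.ofReal (Real.exp (θ * x)) := by
  have hκ : 0 ≤ mu / (mu - s + θ) := div_nonneg hmu.le (by linarith)
  have hℓ : 0 ≤ lam / (lam - s - θ) := div_nonneg hlam.le (by linarith)
  rw [lintegral_continueWeight hα₀ hα₁ _ _ (by fun_prop),
    lintegral_reachWeight hlam hmu (by linarith) hx, mul_zero, Real.exp_zero, ENNReal.ofReal_one,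
    mul_one, ← ENNReal.ofReal_mul (mul_nonneg hκ hℓ),
    ← lintegral_missWeight_add hlam hmu hsθ hsθ' hx, add_comm, mul_assoc (mu / _),
    ENNReal.ofReal_mul hκ]
  gcongr

/-- Harmonicity: `h1` is the balance in the interior, and `h2` makes the part cut off below the
origin equal to what absorption and reflection contribute there. -/
theorem exp_eq_lintegral_absorbWeight_add (hlam : 0 < lam) (hmu : 0 < mu) (hα₀ : 0 ≤ α)
    (hα₁ : α ≤ 1) (hsθ : s - θ < mu) (hsθ' : s + θ < lam) (hK : 0 ≤ K)
    (h1 : mu / (mu - s + θ) * (lam / (lam - s - θ)) = 1)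
    (h2 : K * (mu / (mu - s + θ)) = α + (1 - α) * K) (hx : 0 ≤ x) :
    ENNReal.ofReal K * ENNReal.ofReal (Real.exp (θ * x)) =
      ∫⁻ e, absorbWeight s x e ∂roundMeasure lam mu α +
      ENNReal.ofReal K * ∫⁻ e, continueWeight s x (fun y => ENNReal.ofReal (Real.exp (θ * y))) e
        ∂roundMeasure lam mu α := by
  have hκ : 0 ≤ mu / (mu - s + θ) := div_nonneg hmu.le (by linarith)
  have h := lintegral_missWeight_add hlam hmu hsθ hsθ' hx
  rw [h1, one_mul] at h
  rw [lintegral_continueWeight hα₀ hα₁ _ _ (by fun_prop), lintegral_absorbWeight hα₀ hα₁,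
    lintegral_reachWeight hlam hmu (by linarith) hx, mul_zero, Real.exp_zero, ENNReal.ofReal_one,
    mul_one, ← h, mul_assoc (mu / _), ENNReal.ofReal_mul hκ, mul_add, ← mul_assoc (ENNReal.ofReal K),
    ← ENNReal.ofReal_mul hK, h2, ENNReal.ofReal_add hα₀ (mul_nonneg (by linarith) hK),
    ENNReal.ofReal_mul (by linarith)]
  ring

/-! ### Path functionals and their measurability -/

/-- Height at the beginning of round `n`. -/
noncomputable def roundHeight (z : ℕ → (ℝ × ℝ) × Bool) (n : ℕ) : ℝ :=
  height 0 (fun j => (z j).1.1) (fun j => (z j).1.2) n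

/-- Time at which round `n` begins. -/
noncomputable def roundStart (z : ℕ → (ℝ × ℝ) × Bool) (n : ℕ) : ℝ :=
  ∑ i ∈ Finset.range n, roundDuration 0 (fun j => (z j).1.1) (fun j => (z j).1.2) i

/-- Exponential weight of the paths that are not absorbed before round `n`. -/
noncomputable def survivalWeight (s : ℝ) (z : ℕ → (ℝ × ℝ) × Bool) : ℕ → ℝ≥0∞
  | 0 => 1
  | n + 1 => survivalWeight s z n * continueWeight s (roundHeight z n) 1 (z n)

theorem roundHeight_succ (z : ℕ → (ℝ × ℝ) × Bool) (n : ℕ) :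
    roundHeight z (n + 1) = max (roundHeight z n + (z n).1.1 - (z n).1.2) 0 := rfl

theorem roundHeight_nonneg (z : ℕ → (ℝ × ℝ) × Bool) (n : ℕ) : 0 ≤ roundHeight z n := by
  cases n with
  | zero => exact le_rfl
  | succ n => exact le_max_right _ _

theorem roundStart_succ (z : ℕ → (ℝ × ℝ) × Bool) (n : ℕ) :
    roundStart z (n + 1) =
      roundStart z n + ((z n).1.1 + min (z n).1.2 (roundHeight z n + (z n).1.1)) :=
  Finset.sum_range_succ _ _

open Classical in
theorem survivalWeight_eq (s : ℝ) (z : ℕ → (ℝ × ℝ) × Bool) (n : ℕ) :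
    survivalWeight s z n = if ∀ i < n, ¬ Absorbs (roundHeight z i) (z i) then
      ENNReal.ofReal (Real.exp (s * roundStart z n)) else 0 := by
  induction n with
  | zero => simp [survivalWeight, roundStart]
  | succ n ih =>
    simp only [survivalWeight, ih, continueWeight, Nat.forall_lt_succ_right, roundStart_succ]
    by_cases h1 : ∀ i < n, ¬ Absorbs (roundHeight z i) (z i)
    · by_cases h2 : Absorbs (roundHeight z n) (z n)
      · simp [h2]
      · rw [if_pos h1, if_neg h2, if_pos ⟨h1, h2⟩, Pi.one_apply, mul_one,
          ← ENNReal.ofReal_mul (Real.exp_pos _).le, ← Real.exp_add, ← mul_add]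
    · rw [if_neg h1, zero_mul, if_neg]
      exact fun h => h1 h.1

theorem survivalWeight_succ_mul (s : ℝ) (v : ℝ → ℝ≥0∞) (z : ℕ → (ℝ × ℝ) × Bool) (n : ℕ) :
    survivalWeight s z (n + 1) * v (roundHeight z (n + 1)) =
      survivalWeight s z n * continueWeight s (roundHeight z n) v (z n) := by
  simp only [survivalWeight, continueWeight, roundHeight_succ, mul_assoc]
  split_ifs <;> simp

section Measurability

variable {Ω' : Type*} [MeasurableSpace Ω'] {Z : Ω' → ℕ → (ℝ × ℝ) × Bool} {n : ℕ}

theorem measurable_roundHeight (hZ : ∀ i < n, Measurable fun ω => Z ω i) :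
    Measurable fun ω => roundHeight (Z ω) n := by
  induction n with
  | zero => exact measurable_const
  | succ n ih =>
    have h1 := ih fun i hi => hZ i (by omega)
    have h2 := hZ n (by omega)
    simp only [roundHeight_succ]
    fun_prop

theorem measurable_survivalWeight (s : ℝ) (hZ : ∀ i < n, Measurable fun ω => Z ω i) :
    Measurable fun ω => survivalWeight s (Z ω) n := by
  induction n with
  | zero => exact measurable_const
  | succ n ih =>
    have h1 := measurable_roundHeight (n := n) fun i hi => hZ i (by omega)
    have h2 := hZ n (by omega)
    exact (ih fun i hi => hZ i (by omega)).mul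
      ((measurable_continueWeight s measurable_one).comp (h1.prodMk h2))

theorem measurable_roundStart (hZ : ∀ i < n, Measurable fun ω => Z ω i) :
    Measurable fun ω => roundStart (Z ω) n := by
  induction n with
  | zero => exact measurable_const
  | succ n ih =>
    have h1 := measurable_roundHeight (n := n) fun i hi => hZ i (by omega)
    have h2 := hZ n (by omega)
    have h3 := ih fun i hi => hZ i (by omega)
    simp only [roundStart_succ]
    fun_prop

end Measurability

/-! ### Markov property under the product measure -/

section Canonical

variable (ν : Measure ((ℝ × ℝ) × Bool)) [IsProbabilityMeasure ν]

theorem indepFun_past_infinitePi (s : ℝ) (n : ℕ) :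
    IndepFun (fun z : ℕ → (ℝ × ℝ) × Bool => (survivalWeight s z n, roundHeight z n))
      (fun z => z n) (Measure.infinitePi fun _ : ℕ => ν) := by
  have h : iIndepFun (fun (i : ℕ) (z : ℕ → (ℝ × ℝ) × Bool) => z i)
      (Measure.infinitePi fun _ : ℕ => ν) :=
    iIndepFun_infinitePi (P := fun _ => ν) (X := fun _ => id) fun _ => measurable_id
  have h2 := indep_iSup_of_disjoint (fun i => (measurable_pi_apply i).comap_le) h.iIndep
    (S := Set.Iio n) (T := {n}) (by simp)
  refine indep_of_indep_of_le_left (indep_of_indep_of_le_right h2 ?_) ?_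
  · exact le_iSup₂_of_le n rfl le_rfl
  · rw [← measurable_iff_comap_le]
    -- The past must be measurable for the σ-algebra of the coordinates below `n` alone; the
    -- measurability lemmas assume no other coordinates, so they apply to it.
    have hm : ∀ i < n, Measurable[⨆ i ∈ Set.Iio n, MeasurableSpace.comap
        (fun z : ℕ → (ℝ × ℝ) × Bool => z i) inferInstance] fun z => z i := by
      intro i hi
      rw [measurable_iff_comap_le]
      exact le_iSup₂_of_le (f := fun i (_ : i ∈ Set.Iio n) => MeasurableSpace.comap
        (fun z : ℕ → (ℝ × ℝ) × Bool => z i) inferInstance) i hi le_rfl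
    exact @Measurable.prodMk _ _ _ _ _ (_) _ _ (@measurable_survivalWeight _ (_) _ _ s hm)
      (@measurable_roundHeight _ (_) _ _ hm)

theorem lintegral_survivalWeight_mul (s : ℝ) (n : ℕ) {f : ℝ → (ℝ × ℝ) × Bool → ℝ≥0∞}
    (hf : Measurable fun p : ℝ × ((ℝ × ℝ) × Bool) => f p.1 p.2) :
    ∫⁻ z, survivalWeight s z n * f (roundHeight z n) (z n) ∂Measure.infinitePi (fun _ : ℕ => ν) =
      ∫⁻ z, survivalWeight s z n * ∫⁻ e, f (roundHeight z n) e ∂ν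
        ∂Measure.infinitePi (fun _ : ℕ => ν) := by
  set M := Measure.infinitePi fun _ : ℕ => ν
  have hst : Measurable fun z : ℕ → (ℝ × ℝ) × Bool => (survivalWeight s z n, roundHeight z n) :=
    (measurable_survivalWeight s fun i _ => measurable_pi_apply i).prodMk
      (measurable_roundHeight fun i _ => measurable_pi_apply i)
  have hn : Measurable fun z : ℕ → (ℝ × ℝ) × Bool => z n := measurable_pi_apply n
  have hmap := (indepFun_iff_map_prod_eq_prod_map_map hst.aemeasurable hn.aemeasurable).1
    (indepFun_past_infinitePi ν s n)
  have hν : M.map (fun z => z n) = ν := Measure.infinitePi_map_eval (fun _ => ν) n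
  rw [hν] at hmap
  have hg : Measurable fun p : (ℝ≥0∞ × ℝ) × ((ℝ × ℝ) × Bool) => p.1.1 * f p.1.2 p.2 :=
    measurable_fst.fst.mul (hf.comp (measurable_fst.snd.prodMk measurable_snd))
  have h1 := lintegral_map (μ := M) hg (hst.prodMk hn)
  rw [hmap, lintegral_prod _ hg.aemeasurable, lintegral_map hg.lintegral_prod_right' hst] at h1
  rw [← h1]
  refine lintegral_congr fun z => ?_
  exact lintegral_const_mul _ (hf.comp measurable_prodMk_left)

end Canonical

/-! ### Iteration over rounds -/

section Iteration

variable {lam mu s θ α K : ℝ}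

/-- The law of the sequence of rounds. -/
noncomputable def pathMeasure (lam mu α : ℝ) : Measure (ℕ → (ℝ × ℝ) × Bool) :=
  Measure.infinitePi fun _ => roundMeasure lam mu α

/-- Expected value of `exp (θ * H)` for the height `H` at the beginning of round `n`, weighted by
survival. -/
noncomputable def survivalMean (lam mu α s θ : ℝ) (n : ℕ) : ℝ≥0∞ :=
  ∫⁻ z, survivalWeight s z n * ENNReal.ofReal (Real.exp (θ * roundHeight z n))
    ∂pathMeasure lam mu α

theorem isProbabilityMeasure_roundMeasure (hlam : 0 < lam) (hmu : 0 < mu) (hα₀ : 0 ≤ α)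
    (hα₁ : α ≤ 1) : IsProbabilityMeasure (roundMeasure lam mu α) := by
  have := isProbabilityMeasure_trialMeasure hα₀ hα₁
  have := isProbabilityMeasure_expMeasure hlam
  have := isProbabilityMeasure_expMeasure hmu
  unfold roundMeasure
  infer_instance

theorem survivalMean_succ (hlam : 0 < lam) (hmu : 0 < mu) (hα₀ : 0 ≤ α) (hα₁ : α ≤ 1) (n : ℕ) :
    survivalMean lam mu α s θ (n + 1) =
      ∫⁻ z, survivalWeight s z n * ∫⁻ e, continueWeight s (roundHeight z n)
        (fun y => ENNReal.ofReal (Real.exp (θ * y))) e ∂roundMeasure lam mu α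
        ∂pathMeasure lam mu α := by
  have := isProbabilityMeasure_roundMeasure hlam hmu hα₀ hα₁
  rw [survivalMean, pathMeasure, ← lintegral_survivalWeight_mul _ s n
    (f := fun x => continueWeight s x fun y => ENNReal.ofReal (Real.exp (θ * y)))
    (measurable_continueWeight s (by fun_prop))]
  exact lintegral_congr fun z =>
    survivalWeight_succ_mul s (fun y => ENNReal.ofReal (Real.exp (θ * y))) z n

theorem survivalMean_zero (hlam : 0 < lam) (hmu : 0 < mu) (hα₀ : 0 ≤ α) (hα₁ : α ≤ 1) :
    survivalMean lam mu α s θ 0 = 1 := by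
  have := isProbabilityMeasure_roundMeasure hlam hmu hα₀ hα₁
  simp [survivalMean, survivalWeight, roundHeight, height, pathMeasure]

theorem survivalMean_le_pow (hlam : 0 < lam) (hmu : 0 < mu) (hα₀ : 0 ≤ α)
    (hα₁ : α ≤ 1) (hsθ : s - θ < mu) (hsθ' : s + θ < lam) (hα : 1 - α ≤ mu / (mu - s + θ))
    (n : ℕ) :
    survivalMean lam mu α s θ n ≤
      ENNReal.ofReal (mu / (mu - s + θ) * (lam / (lam - s - θ))) ^ n := by
  induction n with
  | zero => rw [survivalMean_zero hlam hmu hα₀ hα₁, pow_zero]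
  | succ n ih =>
    have h1 : Measurable fun z : ℕ → (ℝ × ℝ) × Bool => survivalWeight s z n :=
      measurable_survivalWeight s fun i _ => measurable_pi_apply i
    have h2 : Measurable fun z : ℕ → (ℝ × ℝ) × Bool => roundHeight z n :=
      measurable_roundHeight fun i _ => measurable_pi_apply i
    rw [survivalMean_succ hlam hmu hα₀ hα₁, pow_succ, mul_comm]
    calc _ ≤ ∫⁻ z, ENNReal.ofReal (mu / (mu - s + θ) * (lam / (lam - s - θ))) *
          (survivalWeight s z n * ENNReal.ofReal (Real.exp (θ * roundHeight z n)))
          ∂pathMeasure lam mu α := by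
          refine lintegral_mono fun z => ?_
          rw [mul_left_comm]
          gcongr
          exact lintegral_continueWeight_exp_le hlam hmu hα₀ hα₁ hsθ hsθ' hα
            (roundHeight_nonneg z n)
      _ = ENNReal.ofReal (mu / (mu - s + θ) * (lam / (lam - s - θ))) *
          survivalMean lam mu α s θ n := lintegral_const_mul _ (by fun_prop)
      _ ≤ _ := by gcongr

/-- Exponential mean of the absorption time on the paths absorbed in round `n`. -/
noncomputable def absorptionMean (lam mu α s : ℝ) (n : ℕ) : ℝ≥0∞ :=
  ∫⁻ z, survivalWeight s z n * absorbWeight s (roundHeight z n) (z n) ∂pathMeasure lam mu α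

theorem survivalMean_eq_add (hlam : 0 < lam) (hmu : 0 < mu) (hα₀ : 0 ≤ α)
    (hα₁ : α ≤ 1) (hsθ : s - θ < mu) (hsθ' : s + θ < lam) (hK : 0 ≤ K)
    (h1 : mu / (mu - s + θ) * (lam / (lam - s - θ)) = 1)
    (h2 : K * (mu / (mu - s + θ)) = α + (1 - α) * K) (n : ℕ) :
    ENNReal.ofReal K * survivalMean lam mu α s θ n =
      absorptionMean lam mu α s n + ENNReal.ofReal K * survivalMean lam mu α s θ (n + 1) := by
  have := isProbabilityMeasure_roundMeasure hlam hmu hα₀ hα₁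
  have m1 : Measurable fun z : ℕ → (ℝ × ℝ) × Bool => survivalWeight s z n :=
    measurable_survivalWeight s fun i _ => measurable_pi_apply i
  have m2 : Measurable fun z : ℕ → (ℝ × ℝ) × Bool => roundHeight z n :=
    measurable_roundHeight fun i _ => measurable_pi_apply i
  have m3 : Measurable fun x => ∫⁻ e, continueWeight s x
      (fun y => ENNReal.ofReal (Real.exp (θ * y))) e ∂roundMeasure lam mu α :=
    (measurable_continueWeight s (by fun_prop)).lintegral_prod_right'
  have m4 : Measurable fun z : ℕ → (ℝ × ℝ) × Bool => survivalWeight s z n *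
      ∫⁻ e, continueWeight s (roundHeight z n)
        (fun y => ENNReal.ofReal (Real.exp (θ * y))) e ∂roundMeasure lam mu α :=
    m1.mul (m3.comp m2)
  rw [survivalMean_succ hlam hmu hα₀ hα₁, absorptionMean, pathMeasure,
    lintegral_survivalWeight_mul _ s n (measurable_absorbWeight s), survivalMean,
    ← lintegral_const_mul _ (by fun_prop), ← lintegral_const_mul _ m4,
    ← lintegral_add_right _ (m4.const_mul _)]
  refine lintegral_congr fun z => ?_
  rw [mul_left_comm, exp_eq_lintegral_absorbWeight_add hlam hmu hα₀ hα₁ hsθ hsθ' hK h1 h2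
    (roundHeight_nonneg z n)]
  ring

/-- The one-round identity telescopes, and `hlim` kills the remainder. -/
theorem tsum_absorptionMean (hlam : 0 < lam) (hmu : 0 < mu) (hα₀ : 0 ≤ α)
    (hα₁ : α ≤ 1) (hsθ : s - θ < mu) (hsθ' : s + θ < lam) (hK : 0 ≤ K)
    (h1 : mu / (mu - s + θ) * (lam / (lam - s - θ)) = 1)
    (h2 : K * (mu / (mu - s + θ)) = α + (1 - α) * K)
    (hlim : Filter.Tendsto (survivalMean lam mu α s θ) Filter.atTop (nhds 0)) :
    ∑' n, absorptionMean lam mu α s n = ENNReal.ofReal K := by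
  have hsum : ∀ n, ENNReal.ofReal K = ∑ k ∈ Finset.range n, absorptionMean lam mu α s k +
      ENNReal.ofReal K * survivalMean lam mu α s θ n := by
    intro n
    induction n with
    | zero => simp [survivalMean_zero hlam hmu hα₀ hα₁]
    | succ n ih =>
      rw [Finset.sum_range_succ, add_assoc,
        ← survivalMean_eq_add hlam hmu hα₀ hα₁ hsθ hsθ' hK h1 h2]
      exact ih
  have t1 := (ENNReal.summable (f := absorptionMean lam mu α s)).hasSum.tendsto_sum_nat
  have t2 := ENNReal.Tendsto.const_mul hlim (.inr (ENNReal.ofReal_ne_top (r := K)))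
  have t3 := t1.add t2
  simp only [← hsum, mul_zero, add_zero] at t3
  exact tendsto_nhds_unique t3 tendsto_const_nhds

/-- At the harmonic exponent a round preserves the interior weight, so no decay is visible there.
Heights are nonnegative, which allows comparison with a larger `θ'` where the factor is below `1`.
-/
theorem tendsto_survivalMean {θ' : ℝ} (hlam : 0 < lam) (hmu : 0 < mu) (hα₀ : 0 ≤ α)
    (hα₁ : α ≤ 1) (hsθ : s - θ' < mu) (hsθ' : s + θ' < lam) (hα : 1 - α ≤ mu / (mu - s + θ'))
    (hρ : mu / (mu - s + θ') * (lam / (lam - s - θ')) < 1) (hθ : θ ≤ θ') :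
    Filter.Tendsto (survivalMean lam mu α s θ) Filter.atTop (nhds 0) := by
  refine tendsto_of_tendsto_of_tendsto_of_le_of_le tendsto_const_nhds
    (ENNReal.tendsto_pow_atTop_nhds_zero_of_lt_one (r := ENNReal.ofReal
      (mu / (mu - s + θ') * (lam / (lam - s - θ')))) (by simpa using hρ)) (fun _ => zero_le)
    fun n => le_trans ?_ (survivalMean_le_pow hlam hmu hα₀ hα₁ hsθ hsθ' hα n)
  refine lintegral_mono fun z => ?_
  have := roundHeight_nonneg z n
  gcongr

end Iteration

/-! ### Absorption time of a path -/

/-- Absorption time of the path with given rounds, started at the origin. -/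
noncomputable def pathAbsorptionTime (z : ℕ → (ℝ × ℝ) × Bool) : ℝ≥0∞ :=
  absorptionTime 0 (fun j => (z j).1.1) (fun j => (z j).1.2) (fun j => (z j).2)

theorem pathAbsorptionTime_eq_iInf (z : ℕ → (ℝ × ℝ) × Bool) :
    pathAbsorptionTime z =
      ⨅ (j : ℕ) (_ : Absorbs (roundHeight z j) (z j)), ENNReal.ofReal (roundStart z (j + 1)) := rfl

theorem measurable_pathAbsorptionTime : Measurable pathAbsorptionTime := by
  classical
  have e : pathAbsorptionTime = fun z => ⨅ j : ℕ, if Absorbs (roundHeight z j) (z j) then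
      ENNReal.ofReal (roundStart z (j + 1)) else ⊤ := by
    ext z
    rw [pathAbsorptionTime_eq_iInf]
    exact iInf_congr fun j => iInf_eq_if _
  rw [e]
  refine Measurable.iInf fun j => Measurable.ite ?_ ?_ measurable_const
  · exact ((measurable_roundHeight fun i _ => measurable_pi_apply i).prodMk
      (measurable_pi_apply j)) measurableSet_absorbs
  · exact (measurable_roundStart fun i _ => measurable_pi_apply i).ennreal_ofReal

theorem monotone_roundStart {z : ℕ → (ℝ × ℝ) × Bool} (hz : ∀ j, 0 < (z j).1.1 ∧ 0 < (z j).1.2) :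
    Monotone (roundStart z) := by
  refine monotone_nat_of_le_succ fun n => ?_
  rw [roundStart_succ]
  have h1 := (hz n).1.le
  have h2 : 0 ≤ min (z n).1.2 (roundHeight z n + (z n).1.1) :=
    le_min (hz n).2.le (add_nonneg (roundHeight_nonneg z n) h1)
  linarith

theorem pathAbsorptionTime_eq {z : ℕ → (ℝ × ℝ) × Bool} (hz : ∀ j, 0 < (z j).1.1 ∧ 0 < (z j).1.2)
    {n : ℕ} (hn : Absorbs (roundHeight z n) (z n))
    (hmin : ∀ i < n, ¬ Absorbs (roundHeight z i) (z i)) :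
    pathAbsorptionTime z = ENNReal.ofReal (roundStart z (n + 1)) := by
  rw [pathAbsorptionTime_eq_iInf]
  refine le_antisymm (iInf₂_le n hn) (le_iInf₂ fun j hj => ENNReal.ofReal_le_ofReal ?_)
  exact monotone_roundStart hz (by by_contra h; exact hmin j (by omega) hj)

/-- Only the first absorbing round contributes: earlier terms have no absorption, later ones no
survival. -/
theorem exp_pathAbsorptionTime {z : ℕ → (ℝ × ℝ) × Bool}
    (hz : ∀ j, 0 < (z j).1.1 ∧ 0 < (z j).1.2) (hex : ∃ n, Absorbs (roundHeight z n) (z n)) (s : ℝ) :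
    ENNReal.ofReal (Real.exp (s * (pathAbsorptionTime z).toReal)) =
      ∑' n, survivalWeight s z n * absorbWeight s (roundHeight z n) (z n) := by
  classical
  have hn := Nat.find_spec hex
  have hmin : ∀ i < Nat.find hex, ¬ Absorbs (roundHeight z i) (z i) :=
    fun i hi => Nat.find_min hex hi
  generalize Nat.find hex = n at hn hmin
  have h0 : 0 ≤ roundStart z (n + 1) := by
    have := monotone_roundStart hz (zero_le (a := n + 1))
    simpa [roundStart] using this
  rw [pathAbsorptionTime_eq hz hn hmin, ENNReal.toReal_ofReal h0, tsum_eq_single n]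
  · rw [survivalWeight_eq, if_pos hmin, absorbWeight, if_pos hn,
      ← ENNReal.ofReal_mul (Real.exp_pos _).le, ← Real.exp_add, ← mul_add, roundStart_succ]
  · intro m hm
    rcases lt_or_gt_of_ne hm with h | h
    · rw [absorbWeight, if_neg (hmin m h), mul_zero]
    · rw [survivalWeight_eq, if_neg fun h' => h' n h hn, zero_mul]

variable {lam mu s θ α K : ℝ}

theorem ae_pos_roundMeasure (hlam : 0 < lam) (hmu : 0 < mu) (hα₀ : 0 ≤ α) (hα₁ : α ≤ 1) :
    ∀ᵐ e ∂roundMeasure lam mu α, 0 < e.1.1 ∧ 0 < e.1.2 := by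
  have := isProbabilityMeasure_trialMeasure hα₀ hα₁
  have := isProbabilityMeasure_expMeasure hlam
  have := isProbabilityMeasure_expMeasure hmu
  have h1 : ∀ᵐ e ∂(expMeasure lam).prod (expMeasure mu), 0 < e.1 ∧ 0 < e.2 :=
    (Measure.quasiMeasurePreserving_fst.ae (ae_pos_expMeasure lam)).and
      (Measure.quasiMeasurePreserving_snd.ae (ae_pos_expMeasure mu))
  exact Measure.quasiMeasurePreserving_fst.ae h1

theorem ae_pos_pathMeasure (hlam : 0 < lam) (hmu : 0 < mu) (hα₀ : 0 ≤ α) (hα₁ : α ≤ 1) :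
    ∀ᵐ z ∂pathMeasure lam mu α, ∀ j, 0 < (z j).1.1 ∧ 0 < (z j).1.2 := by
  have := isProbabilityMeasure_roundMeasure hlam hmu hα₀ hα₁
  refine ae_all_iff.2 fun j => ?_
  exact (measurePreserving_eval_infinitePi (fun _ : ℕ => roundMeasure lam mu α)
    j).quasiMeasurePreserving.ae (ae_pos_roundMeasure hlam hmu hα₀ hα₁)

/-- At `s = θ = 0` the survival mean is the probability of no absorption in the first `n` rounds. -/
theorem ae_exists_absorbs
    (hlim : Filter.Tendsto (survivalMean lam mu α 0 0) Filter.atTop (nhds 0)) :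
    ∀ᵐ z ∂pathMeasure lam mu α, ∃ n, Absorbs (roundHeight z n) (z n) := by
  classical
  rw [ae_iff]
  refine le_antisymm (ge_of_tendsto' hlim fun n => ?_) zero_le
  have hle : ∀ z, Set.indicator {z : ℕ → (ℝ × ℝ) × Bool | ¬ ∃ n, Absorbs (roundHeight z n) (z n)}
      1 z ≤ survivalWeight 0 z n * ENNReal.ofReal (Real.exp (0 * roundHeight z n)) := by
    intro z
    by_cases hz : ∃ n, Absorbs (roundHeight z n) (z n)
    · rw [Set.indicator_of_notMem (by simpa using hz)]
      exact zero_le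
    · rw [Set.indicator_of_mem (by exact hz), survivalWeight_eq, if_pos]
      · simp
      · exact fun i _ hi => hz ⟨i, hi⟩
  refine le_trans ?_ (lintegral_mono hle)
  have hms : MeasurableSet
      {z : ℕ → (ℝ × ℝ) × Bool | ¬ ∃ n, Absorbs (roundHeight z n) (z n)} := by
    simp only [Set.ofPred_exists, ← Set.compl_ofPred]
    refine (MeasurableSet.iUnion fun j => ?_).compl
    exact ((measurable_roundHeight fun i _ => measurable_pi_apply i).prodMk
      (measurable_pi_apply j)) measurableSet_absorbs
  rw [lintegral_indicator_one hms]

theorem lintegral_exp_pathAbsorptionTime (hlam : 0 < lam) (hmu : 0 < mu) (hα₀ : 0 ≤ α)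
    (hα₁ : α ≤ 1) (hex : ∀ᵐ z ∂pathMeasure lam mu α, ∃ n, Absorbs (roundHeight z n) (z n)) (s : ℝ) :
    ∫⁻ z, ENNReal.ofReal (Real.exp (s * (pathAbsorptionTime z).toReal)) ∂pathMeasure lam mu α =
      ∑' n, absorptionMean lam mu α s n := by
  have e : ∀ᵐ z ∂pathMeasure lam mu α,
      ENNReal.ofReal (Real.exp (s * (pathAbsorptionTime z).toReal)) =
      ∑' n, survivalWeight s z n * absorbWeight s (roundHeight z n) (z n) := by
    filter_upwards [hex, ae_pos_pathMeasure hlam hmu hα₀ hα₁] with z h1 h2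
    exact exp_pathAbsorptionTime h2 h1 s
  rw [lintegral_congr_ae e, lintegral_tsum]
  · rfl
  · intro n
    exact ((measurable_survivalWeight s fun i _ => measurable_pi_apply i).mul
      ((measurable_absorbWeight s).comp ((measurable_roundHeight fun i _ =>
        measurable_pi_apply i).prodMk (measurable_pi_apply n)))).aemeasurable

/-! ### Choice of exponents and the moment generating function -/

theorem exists_pos_exp_bound (hmu : 0 < mu) (hlam : mu < lam) (hα₀ : 0 < α) :
    ∃ ε > 0, (1 - α) * (1 + ε) < 1 ∧ ∃ s₀ > 0, ∀ s < s₀,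
      2 * s * (1 + ε) < ε * (lam - mu) - mu * ε ^ 2 := by
  -- The first bound keeps `mu * ε` below `lam - mu`; the second gives `(1 - α) * (1 + ε) ≤ 1 - α ^
  -- 2`.
  set ε := min ((lam - mu) / (2 * mu)) α with hε
  have hε0 : 0 < ε := lt_min (div_pos (by linarith) (by linarith)) hα₀
  have h1 : ε * (2 * mu) ≤ lam - mu := by
    rw [← le_div_iff₀ (by linarith)]; exact min_le_left _ _
  have h2 : ε ≤ α := min_le_right _ _
  have h3 : 0 < ε * (lam - mu) - mu * ε ^ 2 := by
    have : 0 < ε * (lam - mu - mu * ε) := mul_pos hε0 (by nlinarith)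
    linarith [this, show ε * (lam - mu - mu * ε) = ε * (lam - mu) - mu * ε ^ 2 by ring]
  refine ⟨ε, hε0, by nlinarith, (ε * (lam - mu) - mu * ε ^ 2) / (2 * (1 + ε)), by positivity,
    fun s hs => ?_⟩
  rw [lt_div_iff₀ (by positivity)] at hs
  linarith

/-- The exponent `s + mu * ε` corresponds to `1 + ε` in the role of `ρ`. The quadratic is negative
there, and this is the same as the one-round factor being less than `1`. -/
theorem tendsto_survivalMean_of_bound {ε : ℝ} (hlam : 0 < lam) (hmu : 0 < mu) (hα₀ : 0 ≤ α)
    (hα₁ : α ≤ 1) (hε : 0 < ε) (hαε : (1 - α) * (1 + ε) < 1)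
    (hsε : 2 * s * (1 + ε) < ε * (lam - mu) - mu * ε ^ 2) (hθ : θ ≤ s + mu * ε) :
    Filter.Tendsto (survivalMean lam mu α s θ) Filter.atTop (nhds 0) := by
  have e1 : mu - s + (s + mu * ε) = mu * (1 + ε) := by ring
  have hk : mu / (mu - s + (s + mu * ε)) = 1 / (1 + ε) := by
    rw [e1]; field_simp
  have hl : lam < (1 + ε) * (lam - s - (s + mu * ε)) := by nlinarith
  have hl0 : 0 < lam - s - (s + mu * ε) := by
    by_contra h
    push Not at h
    nlinarith [mul_nonneg (neg_nonneg.2 h) (by linarith : 0 ≤ 1 + ε)]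
  refine tendsto_survivalMean (θ' := s + mu * ε) hlam hmu hα₀ hα₁ ?_ (by linarith) ?_ ?_ hθ
  · nlinarith [mul_pos hmu hε]
  · rw [hk, le_div_iff₀ (by positivity)]; exact hαε.le
  · rw [hk, div_mul_div_comm, one_mul, div_lt_one (by positivity)]
    exact hl

theorem ae_exists_absorbs_pathMeasure (hmu : 0 < mu) (hlam : mu < lam) (hα₀ : 0 < α)
    (hα₁ : α < 1) :
    ∀ᵐ z ∂pathMeasure lam mu α, ∃ n, Absorbs (roundHeight z n) (z n) := by
  obtain ⟨ε, hε, hαε, s₀, hs₀, h⟩ := exists_pos_exp_bound hmu hlam hα₀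
  refine ae_exists_absorbs ?_
  exact tendsto_survivalMean_of_bound (hmu.trans hlam) hmu hα₀.le hα₁.le hε hαε (h 0 hs₀)
    (by positivity)

theorem ae_pathAbsorptionTime_lt_top (hmu : 0 < mu) (hlam : mu < lam) (hα₀ : 0 < α)
    (hα₁ : α < 1) : ∀ᵐ z ∂pathMeasure lam mu α, pathAbsorptionTime z < ∞ := by
  filter_upwards [ae_exists_absorbs_pathMeasure hmu hlam hα₀ hα₁] with z ⟨n, hn⟩
  exact (iInf₂_le n hn).trans_lt ENNReal.ofReal_lt_top

theorem exists_lintegral_exp_pathAbsorptionTime (hmu : 0 < mu) (hlam : mu < lam) (hα₀ : 0 < α)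
    (hα₁ : α < 1) :
    ∃ s₀ > 0, ∀ s ∈ Set.Ioo 0 s₀, ∃ ρ K, SumsTo (cycleSeries lam mu) s ρ ∧
      mu * ρ ^ 2 - (lam + mu - 2 * s) * ρ + lam = 0 ∧ 0 < ρ ∧ K = ρ * (α + (1 - α) * K) ∧ 0 ≤ K ∧
      ∫⁻ z, ENNReal.ofReal (Real.exp (s * (pathAbsorptionTime z).toReal)) ∂pathMeasure lam mu α =
        ENNReal.ofReal K := by
  obtain ⟨ε, hε, hαε, s₀, hs₀, h⟩ := exists_pos_exp_bound hmu hlam hα₀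
  refine ⟨s₀, hs₀, fun s hs => ?_⟩
  have hl0 := hmu.trans hlam
  obtain ⟨ρ, h1, h2, h3, h4⟩ := cycleSeries_sumsTo hmu hl0 hs.1 hε (h s hs.2)
  have hd : 0 < 1 - (1 - α) * ρ := by
    have : (1 - α) * ρ ≤ (1 - α) * (1 + ε) := by
      have : 0 ≤ 1 - α := by linarith
      gcongr
    linarith
  have hK : α * ρ / (1 - (1 - α) * ρ) =
      ρ * (α + (1 - α) * (α * ρ / (1 - (1 - α) * ρ))) := by
    linear_combination div_mul_cancel₀ (α * ρ) hd.ne'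
  refine ⟨ρ, α * ρ / (1 - (1 - α) * ρ), h1, h2, h3, hK, by positivity, ?_⟩
  rw [lintegral_exp_pathAbsorptionTime hl0 hmu hα₀.le hα₁.le
    (ae_exists_absorbs_pathMeasure hmu hlam hα₀ hα₁)]
  -- With `θ = s + mu * (ρ - 1)` the two factors become `1 / ρ` and `ρ`, the latter by the
  -- quadratic; `ρ ≤ 1 + ε` puts `θ` below the contracting exponent.
  have e1 : mu - s + (s + mu * (ρ - 1)) = mu * ρ := by ring
  have e2 : lam - s - (s + mu * (ρ - 1)) = lam / ρ := by
    rw [eq_div_iff h3.ne']; linear_combination -h2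
  have e3 : mu / (mu - s + (s + mu * (ρ - 1))) = 1 / ρ := by rw [e1]; field_simp
  have e4 : 0 < lam / ρ := by positivity
  refine tsum_absorptionMean (θ := s + mu * (ρ - 1)) hl0 hmu hα₀.le hα₁.le ?_ (by linarith)
    (by positivity) ?_ ?_ ?_
  · nlinarith [mul_pos hmu h3]
  · rw [e3, e2]; field_simp
  · rw [e3]
    generalize α * ρ / (1 - (1 - α) * ρ) = K at hK ⊢
    rw [mul_one_div, div_eq_iff h3.ne']
    linear_combination hK
  · refine tendsto_survivalMean_of_bound hl0 hmu hα₀.le hα₁.le hε hαε (h s hs.2) ?_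
    have : mu * (ρ - 1) ≤ mu * ε := by gcongr; linarith
    linarith

/-! ### Law of the sequence of rounds -/

theorem map_zip_infinitePi {E F : Type*} [MeasurableSpace E] [MeasurableSpace F] (μ : Measure E)
    (ν : Measure F) [IsProbabilityMeasure μ] [IsProbabilityMeasure ν] :
    ((Measure.infinitePi fun _ : ℕ => μ).prod (Measure.infinitePi fun _ : ℕ => ν)).map
      (fun p j => (p.1 j, p.2 j)) = Measure.infinitePi fun _ : ℕ => μ.prod ν := by
  have hm : Measurable fun (p : (ℕ → E) × (ℕ → F)) (j : ℕ) => (p.1 j, p.2 j) := by fun_prop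
  refine ((Measure.isProjectiveLimit_infinitePi fun _ : ℕ => μ.prod ν).unique fun s => ?_).symm
  have h := (measurePreserving_arrowProdEquivProdArrow E F s (fun _ => μ) (fun _ => ν)).symm
  rw [← h.map_eq, ← Measure.infinitePi_map_restrict (fun _ : ℕ => μ),
    ← Measure.infinitePi_map_restrict (fun _ : ℕ => ν),
    Measure.map_prod_map _ _ (Finset.measurable_restrict s) (Finset.measurable_restrict s),
    Measure.map_map h.measurable ((Finset.measurable_restrict s).prodMap
      (Finset.measurable_restrict s)), Measure.map_map (Finset.measurable_restrict s) hm]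
  rfl

theorem map_zip_eq_infinitePi {Ω E F : Type*} [MeasurableSpace Ω] [MeasurableSpace E]
    [MeasurableSpace F] {P : Measure Ω} [IsProbabilityMeasure P] {μ : Measure E} {ν : Measure F}
    [IsProbabilityMeasure μ] [IsProbabilityMeasure ν] {X : ℕ → Ω → E} {Y : ℕ → Ω → F}
    (hXm : ∀ j, AEMeasurable (X j) P) (hYm : ∀ j, AEMeasurable (Y j) P)
    (hX : P.map (fun ω j => X j ω) = Measure.infinitePi fun _ => μ)
    (hY : P.map (fun ω j => Y j ω) = Measure.infinitePi fun _ => ν)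
    (hXY : IndepFun (fun ω j => X j ω) (fun ω j => Y j ω) P) :
    P.map (fun ω j => (X j ω, Y j ω)) = Measure.infinitePi fun _ => μ.prod ν := by
  have mX : AEMeasurable (fun ω j => X j ω) P := aemeasurable_pi_iff.2 hXm
  have mY : AEMeasurable (fun ω j => Y j ω) P := aemeasurable_pi_iff.2 hYm
  have hm : Measurable fun (p : (ℕ → E) × (ℕ → F)) (j : ℕ) => (p.1 j, p.2 j) := by fun_prop
  have h := (indepFun_iff_map_prod_eq_prod_map_map mX mY).1 hXY
  rw [hX, hY] at h
  rw [← map_zip_infinitePi, ← h, AEMeasurable.map_map_of_aemeasurable hm.aemeasurable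
    (mX.prodMk mY)]
  rfl

theorem map_trial_eq {Ω : Type*} [MeasurableSpace Ω] {P : Measure Ω} [IsProbabilityMeasure P]
    {α : ℝ} (hα₀ : 0 ≤ α) {B : Ω → Bool} (hB : AEMeasurable B P)
    (h : P {ω | B ω = true} = ENNReal.ofReal α) : P.map B = trialMeasure α := by
  have htrue : P.map B {true} = ENNReal.ofReal α := by
    rw [Measure.map_apply_of_aemeasurable hB (measurableSet_singleton _), ← h]
    rfl
  have : IsProbabilityMeasure (P.map B) := Measure.isProbabilityMeasure_map hB
  refine Measure.ext_of_singleton fun b => ?_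
  cases b
  · have hc : ({false} : Set Bool) = {true}ᶜ := by ext b; cases b <;> simp
    rw [hc, prob_compl_eq_one_sub (measurableSet_singleton _), htrue]
    simp [trialMeasure, ENNReal.ofReal_sub _ hα₀]
  · rw [htrue]
    simp [trialMeasure]

theorem IsElasticTelegraph.map_rounds {Ω : Type*} [MeasurableSpace Ω] {P : Measure Ω}
    [IsProbabilityMeasure P] {lam mu α : ℝ} {U D : ℕ → Ω → ℝ} {B : ℕ → Ω → Bool}
    (hX : IsElasticTelegraph P lam mu α U D B) (hlam : 0 < lam) (hmu : 0 < mu) (hα₀ : 0 ≤ α)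
    (hα₁ : α ≤ 1) :
    P.map (fun ω j => ((U j ω, D j ω), B j ω)) = pathMeasure lam mu α := by
  have := isProbabilityMeasure_trialMeasure hα₀ hα₁
  have := isProbabilityMeasure_expMeasure hlam
  have := isProbabilityMeasure_expMeasure hmu
  have mU := fun j => (hX.law_up j).aemeasurable
  have mD := fun j => (hX.law_down j).aemeasurable
  have mB := hX.aemeasurable_trial
  have hU := hX.indep_up.map_fun_eq_infinitePi_map₀' mU
  have hD := hX.indep_down.map_fun_eq_infinitePi_map₀' mD
  have hB := hX.indep_trial.map_fun_eq_infinitePi_map₀' mB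
  simp only [fun j => (hX.law_up j).map_eq] at hU
  simp only [fun j => (hX.law_down j).map_eq] at hD
  simp only [fun j => map_trial_eq hα₀ (mB j) (hX.prob_trial j)] at hB
  have hUD := map_zip_eq_infinitePi mU mD hU hD hX.indep_up_down
  have hzip : Measurable fun (p : (ℕ → ℝ) × (ℕ → ℝ)) (j : ℕ) => (p.1 j, p.2 j) := by fun_prop
  refine map_zip_eq_infinitePi (X := fun j ω => (U j ω, D j ω)) (Y := B)
    (fun j => (mU j).prodMk (mD j)) mB hUD hB ?_
  exact hX.indep_motion_trial.comp hzip measurable_id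

/-! ### From exponential moments to moments -/

/-- Tonelli for the exponential series: with `s` positive and `τ` nonnegative all terms are
nonnegative, so one finite exponential moment yields every moment. -/
theorem integrable_pow_and_hasSum_of_lintegral_exp {Ω : Type*} [MeasurableSpace Ω] {P : Measure Ω}
    {τ : Ω → ℝ} (hτ : Measurable τ) (hτ0 : ∀ ω, 0 ≤ τ ω) {s K : ℝ} (hs : 0 < s) (hK : 0 ≤ K)
    (h : ∫⁻ ω, ENNReal.ofReal (Real.exp (s * τ ω)) ∂P = ENNReal.ofReal K) :
    (∀ n, Integrable (fun ω => τ ω ^ n) P) ∧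
      HasSum (fun n => (∫ ω, τ ω ^ n ∂P) / (n ! : ℝ) * s ^ n) K := by
  set f : ℕ → Ω → ℝ := fun n ω => (s * τ ω) ^ n / (n ! : ℝ) with hf
  have hf0 : ∀ n ω, 0 ≤ f n ω := fun n ω => by
    have := hτ0 ω
    positivity
  have hfm : ∀ n, Measurable (f n) := fun n => by fun_prop
  have hexp : ∀ ω, ENNReal.ofReal (Real.exp (s * τ ω)) = ∑' n, ENNReal.ofReal (f n ω) := by
    intro ω
    rw [← ENNReal.ofReal_tsum_of_nonneg (fun n => hf0 n ω) (Real.summable_pow_div_factorial _),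
      Real.exp_eq_exp_ℝ, NormedSpace.exp_eq_tsum_div]
  have htsum : ∑' n, ∫⁻ ω, ENNReal.ofReal (f n ω) ∂P = ENNReal.ofReal K := by
    rw [← h, ← lintegral_tsum fun n => (hfm n).ennreal_ofReal.aemeasurable]
    exact lintegral_congr fun ω => (hexp ω).symm
  have hne : ∑' n, ∫⁻ ω, ENNReal.ofReal (f n ω) ∂P ≠ ∞ := htsum ▸ ENNReal.ofReal_ne_top
  have hfin := ENNReal.ne_top_of_tsum_ne_top hne
  have hint : ∀ n, Integrable (f n) P := fun n =>
    (lintegral_ofReal_ne_top_iff_integrable (hfm n).aestronglyMeasurable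
      (.of_forall (hf0 n))).1 (hfin n)
  have hfe : ∀ n ω, f n ω = s ^ n / (n ! : ℝ) * τ ω ^ n := fun n ω => by
    simp only [hf, mul_pow]
    ring
  refine ⟨fun n => ?_, ?_⟩
  · have h' := (hint n).const_mul ((n ! : ℝ) / s ^ n)
    refine h'.congr (.of_forall fun ω => ?_)
    simp only [hfe]
    field_simp
  · have hs' := ENNReal.hasSum_toReal hne
    rw [← ENNReal.tsum_toReal_eq hfin, htsum, ENNReal.toReal_ofReal hK] at hs'
    refine hs'.congr_fun fun n => ?_
    rw [← integral_eq_lintegral_of_nonneg_ae (.of_forall (hf0 n)) (hfm n).aestronglyMeasurable]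
    simp only [hfe]
    rw [integral_const_mul]
    ring

/-- The power series whose `n`-th coefficient is `1 / n!` times the `n`-th moment of the absorption
time. -/
noncomputable def absorptionSeries (lam mu α : ℝ) : PowerSeries ℝ :=
  PowerSeries.mk fun n => (∫ z, (pathAbsorptionTime z).toReal ^ n ∂pathMeasure lam mu α) / (n ! : ℝ)

theorem absorptionSeries_spec {lam mu α : ℝ} (hmu : 0 < mu) (hlam : mu < lam) (hα₀ : 0 < α)
    (hα₁ : α < 1) :
    (∀ n, Integrable (fun z => (pathAbsorptionTime z).toReal ^ n) (pathMeasure lam mu α)) ∧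
      ∃ s₀ > 0, IsGeometricCompound lam mu α (absorptionSeries lam mu α) s₀ := by
  obtain ⟨s₀, hs₀, h⟩ := exists_lintegral_exp_pathAbsorptionTime hmu hlam hα₀ hα₁
  have key := fun {s K : ℝ} => integrable_pow_and_hasSum_of_lintegral_exp
    (P := pathMeasure lam mu α) measurable_pathAbsorptionTime.ennreal_toReal
    (fun _ => ENNReal.toReal_nonneg) (s := s) (K := K)
  refine ⟨?_, s₀, hs₀, fun s hs => ?_⟩
  · have hs : s₀ / 2 ∈ Set.Ioo 0 s₀ := ⟨by linarith, by linarith⟩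
    obtain ⟨ρ, K, -, -, -, -, hK, hint⟩ := h _ hs
    exact (key hs.1 hK hint).1
  · obtain ⟨ρ, K, h1, h2, h3, h4, hK, hint⟩ := h s hs
    refine ⟨ρ, K, h1, h2, h3, h4, ?_⟩
    simpa only [SumsTo, absorptionSeries, PowerSeries.coeff_mk] using (key hs.1 hK hint).2

theorem coeff_zero_absorptionSeries {lam mu α : ℝ} (hlam : 0 < lam) (hmu : 0 < mu) (hα₀ : 0 ≤ α)
    (hα₁ : α ≤ 1) : PowerSeries.coeff 0 (absorptionSeries lam mu α) = 1 := by
  have := isProbabilityMeasure_roundMeasure hlam hmu hα₀ hα₁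
  simp [absorptionSeries, pathMeasure, -PowerSeries.coeff_zero_eq_constantCoeff]

end ElasticTelegraph


theorem mainTheorem5 {Ω : Type*} [MeasurableSpace Ω] (P : Measure Ω) [IsProbabilityMeasure P]
    (lam mu α : ℝ) (hmu : 0 < mu) (hlam : mu < lam) (hα₀ : 0 < α) (hα₁ : α < 1)
    (U D : ℕ → Ω → ℝ) (B : ℕ → Ω → Bool)
    (hX : ElasticTelegraph.IsElasticTelegraph P lam mu α U D B)
    (A₀ : Ω → ℝ≥0∞)
    (hA₀ : ∀ ω, A₀ ω = ElasticTelegraph.absorptionTime 0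
      (fun j => U j ω) (fun j => D j ω) (fun j => B j ω)) :
    (∀ᵐ ω ∂P, A₀ ω < ∞) ∧
    (∀ n : ℕ, 1 ≤ n → Integrable (fun ω => (A₀ ω).toReal ^ n) P) ∧
    (mu + lam * (α - 1) ≠ 0 → ∀ n : ℕ, 1 ≤ n →
      ∫ ω, (A₀ ω).toReal ^ n ∂P =
        2 * α * lam * (n ! : ℝ) / (4 * lam * α * (mu + lam * (α - 1))) ^ (n + 1) *
          ((2 * mu + 2 * lam * (α - 1)) * (8 * lam * (α - 1)) ^ n +
            ∑ h ∈ Finset.Icc 1 n,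
              (4 * lam * α * (mu + lam * (α - 1))) ^ h * (8 * lam * (α - 1)) ^ (n - h) *
                (lam * mu * 2 ^ (h + 1) / (lam + mu) ^ (h + 1)) *
                ordinaryHypergeometric (((h : ℝ) + 1) / 2) (((h : ℝ) + 2) / 2) (2 : ℝ)
                  (4 * lam * mu / (lam + mu) ^ 2))) ∧
    ∫ ω, (A₀ ω).toReal ∂P = 2 / (α * (lam - mu)) ∧
    variance (fun ω => (A₀ ω).toReal) P =
      4 * (lam + mu * (2 * α - 1)) / (α ^ 2 * (lam - mu) ^ 3) := by
  have hl0 := hmu.trans hlam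
  -- The absorption time is a measurable function of the rounds, so all claims transfer from the
  -- product measure.
  have hmap := hX.map_rounds hl0 hmu hα₀.le hα₁.le
  have hZ : AEMeasurable (fun ω j => ((U j ω, D j ω), B j ω)) P :=
    aemeasurable_pi_iff.2 fun j => ((hX.law_up j).aemeasurable.prodMk
      (hX.law_down j).aemeasurable).prodMk (hX.aemeasurable_trial j)
  have hA : ∀ ω, A₀ ω = ElasticTelegraph.pathAbsorptionTime fun j => ((U j ω, D j ω), B j ω) := hA₀
  obtain ⟨hint, s₀, hs₀, hG⟩ := ElasticTelegraph.absorptionSeries_spec hmu hlam hα₀ hα₁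
  have h0 := ElasticTelegraph.coeff_zero_absorptionSeries hl0 hmu hα₀.le hα₁.le
  have hpm : ∀ n : ℕ, Measurable fun z =>
      (ElasticTelegraph.pathAbsorptionTime z).toReal ^ n := fun n =>
    ElasticTelegraph.measurable_pathAbsorptionTime.ennreal_toReal.pow_const n
  have hintP : ∀ n : ℕ, Integrable (fun ω => (A₀ ω).toReal ^ n) P := fun n => by
    simp only [hA]
    exact (integrable_map_measure (hpm n).aestronglyMeasurable hZ).1 (hmap ▸ hint n)
  have hmom : ∀ n : ℕ, ∫ ω, (A₀ ω).toReal ^ n ∂P =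
      (n ! : ℝ) * PowerSeries.coeff n (ElasticTelegraph.absorptionSeries lam mu α) := fun n => by
    rw [ElasticTelegraph.absorptionSeries, PowerSeries.coeff_mk,
      mul_div_cancel₀ _ (by positivity), ← hmap, integral_map hZ (hpm n).aestronglyMeasurable]
    simp only [hA]
  have h1 : ∫ ω, (A₀ ω).toReal ∂P =
      PowerSeries.coeff 1 (ElasticTelegraph.absorptionSeries lam mu α) := by
    simpa using hmom 1
  refine ⟨?_, fun n _ => hintP n, fun hm n _ => ?_, ?_, ?_⟩
  · simp only [hA]
    exact ae_of_ae_map hZ (hmap ▸ ElasticTelegraph.ae_pathAbsorptionTime_lt_top hmu hlam hα₀ hα₁)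
  · rw [hmom, hG.coeff_eq hs₀ hα₀ hmu hlam h0 hm]
    ring
  · rw [h1, hG.coeff_one hs₀ hα₀ hlam h0]
  · have hAm : AEStronglyMeasurable (fun ω => (A₀ ω).toReal) P := by
      simpa using (hintP 1).aestronglyMeasurable
    rw [variance_eq_sub ((memLp_two_iff_integrable_sq hAm).2 (hintP 2)), h1,
      ← hG.coeff_two hs₀ hα₀ hlam h0]
    have h2 := hmom 2
    rw [Nat.factorial_two, Nat.cast_ofNat] at h2
    rw [← h2]
    rfl
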